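/- Conventions. A BIDMC has input alphabet $\{0,1\}$ (uniformly distributed input) and a discrete output alphabet $\mathcal Y$. Its error probability is $P_\epsilon(W)=\frac12\sum_{y}\min\{\Pr(y|0),\Pr(y|1)\}$. Its LR-profile $P_W$ assigns to $\varepsilon\in[0,1]$ the probability that the output $y$ has likelihood ratio $\Pr(y|0)/\Pr(y|1)=\varepsilon/(1-\varepsilon)$; $W\cong W'$ means $P_W=P_{W'}$. $W'\preccurlyeq W$ ($W'$ is a degradation of $W$) means that $W'$ is $W$ followed by some channel from the outputs of $W$ to the outputs of $W'$. $\mathrm B(\varepsilon)$ is the binary symmetric channel with crossover probability $\varepsilon$, and $\sum_j p_jW_j$ (with $p_j\ge 0$, $\sum_j p_j=1$) is the channel that uses $W_j$ with probability $p_j$, the index $j$ being revealed to the receiver. $\mathbb B_n$ is the set of BIDMCs equivalent to some $\sum_{j=1}^n p_j\mathrm B(\varepsilon_j)$, and $\mathbb B_n^*=\mathbb B_n\setminus\mathbb B_{n-1}$. For $W\in\mathbb B_n$ and $Q\in\mathbb B_m$, $W\preccurlyeq_{\mathrm P}Q$ means $W\preccurlyeq Q$ and $P_\epsilon(W)=\min\{P_\epsilon(W'):W'\in\mathbb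 B_n,\ W'\preccurlyeq Q\}$. Let $Q=\sum_{i=1}^m q_i\mathrm B(\sigma_i)\in\mathbb B_m^*$ with $0\le\sigma_1<\cdots<\sigma_m\le 1/2$, and put $q_0=q_{m+1}=0$. For $1\le i_2<\cdots<i_n\le m$ and $0\le s_j\le q_{i_j}$ ($2\le j\le n$), with $i_1=s_1=0$, $i_{n+1}=m+1$, $s_{n+1}=0$, the notation $D_Q(i_2,\dots,i_n;s_2,\dots,s_n)$ stands for the channel $\sum_{j=1}^n p_j\mathrm B(\varepsilon_j)\in\mathbb B_n^*$ with $$p_j=s_j+\sum_{i_j<i<i_{j+1}}q_i+(q_{i_{j+1}}-s_{j+1}),\qquad p_j\varepsilon_j=s_j\sigma_{i_j}+\sum_{i_j<i<i_{j+1}}q_i\sigma_i+(q_{i_{j+1}}-s_{j+1})\sigma_{i_{j+1}}$$ for $1\le j\le n$ (terms with coefficient zero being omitted). Theorem. Let $m>n\ge 2$, let $Q$ be as above, and let $W\in\mathbb B_n$ with $W\preccurlyeq Q$. Then there exist $1\le i_2<\cdots<i_n\le m$ and $0\le s_j\le q_{i_j}$ ($j=2,\dots,n$) such that $D=D_Q(i_2,\dots,i_n;s_2,\dots,s_n)=\sum_{j=1}^n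 p_j\mathrm B(\varepsilon_j)$ is in $\mathbb B_n^*$, $0\le\varepsilon_1<\cdots<\varepsilon_n\le 1/2$, and $$W\preccurlyeq D\preccurlyeq_{\mathrm P}Q,$$ where moreover $W\preccurlyeq_{\mathrm P}D$ if $W\preccurlyeq_{\mathrm P}Q$. Furthermore, for each $j\in\{1,\dots,n\}$ with $i_{j+1}=i_j+1$: 1. if $s_j=0$, then $s_{j+1}=0$, $p_j=q_{i_{j+1}}$ and $\varepsilon_j=\sigma_{i_{j+1}}$; 2. if $s_{j+1}=q_{i_{j+1}}$, then $s_j=q_{i_j}$, $p_j=q_{i_j}$ and $\varepsilon_j=\sigma_{i_j}$. (Here 1 says for $j=n$ that $s_n=0$ is impossible when $i_n=m$, and 2 says for $j=1$ that $s_2=q_1$ is impossible when $i_2=1$.) Moreover $p_j\ge q_i$ whenever $\varepsilon_j=\sigma_i$; and $p_1\ge q_1$ and $p_n\ge q_m$. -/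

import Mathlib

open scoped ENNReal

noncomputable section

/-- A binary-input discrete memoryless channel: for each input bit `x` a probability mass function
`law x` on the output alphabet, `law x y = Pr(y | x)`. -/
structure BIDMC where
  /-- the output alphabet -/
  Out : Type
  /-- the transition probabilities -/
  law : ZMod 2 → PMF Out

namespace BIDMC

/-- Decoding error probability of maximum likelihood decoding under the uniform input. -/
def errorProb (W : BIDMC) : ℝ≥0∞ :=
  2⁻¹ * ∑' y, min (W.law 0 y) (W.law 1 y)

/-- The outputs whose likelihood ratio `Pr(y | 0) / Pr(y | 1)` equals `ε / (1 - ε)`; the ratio is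
taken in `[0, ∞]`, so that `ε = 1` corresponds to `∞`. (Outputs of probability zero have ratio
`0 / 0 = 0` and do not contribute to any probability.) -/
def lrSet (W : BIDMC) (ε : unitInterval) : Set W.Out :=
  {y | W.law 0 y / W.law 1 y = ENNReal.ofReal (ε : ℝ) / ENNReal.ofReal (1 - (ε : ℝ))}

/-- The likelihood-ratio profile: `P_W(ε)` is the probability, under the uniform input, that the
output lies in `lrSet W ε`. -/
def lrProfile (W : BIDMC) (ε : unitInterval) : ℝ≥0∞ :=
  ∑' y : W.lrSet ε, 2⁻¹ * (W.law 0 y + W.law 1 y)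

/-- Equivalence of channels: equality of the likelihood-ratio profiles. -/
def Equivalent (W W' : BIDMC) : Prop :=
  ∀ ε : unitInterval, W.lrProfile ε = W'.lrProfile ε

/-- `W'.IsDegradation W`: `W'` is obtained from `W` by an intermediate channel `K`, i.e.
`Pr(y' | x) = ∑ y, Pr(y | x) K(y' | y)`. -/
def IsDegradation (W' W : BIDMC) : Prop :=
  ∃ K : W.Out → PMF W'.Out, ∀ x : ZMod 2, W'.law x = (W.law x).bind K

/-- The binary symmetric channel `B(ε)` with crossover probability `ε`. -/
def bsc (ε : unitInterval) : BIDMC where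
  Out := ZMod 2
  law x := PMF.ofFintype
    (fun y => if y = x then ENNReal.ofReal (1 - (ε : ℝ)) else ENNReal.ofReal (ε : ℝ)) (by
      have h : ENNReal.ofReal (1 - (ε : ℝ)) + ENNReal.ofReal (ε : ℝ) = 1 := by
        rw [← ENNReal.ofReal_add (sub_nonneg.2 ε.2.2) ε.2.1]
        simp
      have h' : ENNReal.ofReal (ε : ℝ) + ENNReal.ofReal (1 - (ε : ℝ)) = 1 := by
        rw [add_comm]
        exact h
      change ∑ y : Fin 2, _ = _
      rw [Fin.sum_univ_two]
      fin_cases x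
      · exact h
      · exact h')

/-- A probability vector as a probability mass function. -/
def weightPMF {n : ℕ} (p : stdSimplex ℝ (Fin n)) : PMF (Fin n) :=
  PMF.ofFintype (fun j => ENNReal.ofReal (p j)) (by
    have h := ENNReal.ofReal_sum_of_nonneg (s := Finset.univ) (fun j _ => p.2.1 j)
    exact h.symm.trans ((congrArg ENNReal.ofReal p.2.2).trans ENNReal.ofReal_one))

/-- The random switching channel `∑ j, p j • W j`: the input is sent over `W j` with
probability `p j`, and the receiver sees which sub-channel was used. -/
def rsc {n : ℕ} (p : stdSimplex ℝ (Fin n)) (W : Fin n → BIDMC) : BIDMC where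
  Out := Σ j, (W j).Out
  law x := (weightPMF p).bind fun j => ((W j).law x).map (Sigma.mk j)

/-- The random switching channel `∑ j, p j • B(ε j)` of binary symmetric channels. -/
def bscMix {n : ℕ} (p : stdSimplex ℝ (Fin n)) (ε : Fin n → unitInterval) : BIDMC :=
  rsc p fun j => bsc (ε j)

/-- The set `𝔹_n` of the channels that are equivalent to a random switching channel of `n` binary
symmetric channels (such channels are automatically symmetric). -/
def SymSet (n : ℕ) : Set BIDMC :=
  {W | ∃ (p : stdSimplex ℝ (Fin n)) (ε : Fin n → unitInterval), W.Equivalent (bscMix p ε)}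

/-- The set `𝔹*_n = 𝔹_n \ 𝔹_{n-1}` (used for `n > 1`). -/
def SymSetStar (n : ℕ) : Set BIDMC :=
  SymSet n \ SymSet (n - 1)

/-- `W` is a `(2m, 2n)`-P-degradation of `Q`: `Q ∈ 𝔹_m`, and `W` is a degradation of `Q` in `𝔹_n`
whose decoding error probability is the least among all degradations of `Q` in `𝔹_n`. -/
def IsPDegradation (m n : ℕ) (W Q : BIDMC) : Prop :=
  Q ∈ SymSet m ∧ W ∈ SymSet n ∧ W.IsDegradation Q ∧
    IsLeast (errorProb '' {W' | W' ∈ SymSet n ∧ W'.IsDegradation Q}) W.errorProb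

/-- Extension of a family with labels `1, …, m` (the entry labelled `l` is `f ⟨l - 1, _⟩`) to all
labels, by zero. -/
def labelled {m : ℕ} (f : Fin m → ℝ) (l : ℕ) : ℝ :=
  if h : 1 ≤ l ∧ l ≤ m then f ⟨l - 1, by omega⟩ else 0

/-- The weights `r_l` of the `(a, b; t, t')`-segment `∑_{a ≤ l ≤ b} r_l B(σ_l)` of a channel
`∑_{1 ≤ l ≤ m} q_l B(σ_l)`, where `a < b`: `r_a = t`, `r_b = q_b - t'`, and `r_l = q_l` for
`a < l < b`. -/
def segment {m : ℕ} (q : Fin m → ℝ) (a b : ℕ) (t t' : ℝ) (l : ℕ) : ℝ :=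
  if l = a then t
  else if l = b then labelled q b - t'
  else if a < l ∧ l < b then labelled q l
  else 0

/-- The particle `p B(ε)` is compounded from the particles `k_l B(σ_l)`, `l ∈ S`. -/
def IsCompounded (p ε : ℝ) (S : Finset ℕ) (k σ : ℕ → ℝ) : Prop :=
  p = ∑ l ∈ S, k l ∧ (∀ l ∈ S, σ l ∈ Set.Icc (0 : ℝ) (1 / 2)) ∧ p * ε = ∑ l ∈ S, k l * σ l

/-- Splitting patterns `(i_2, s_2), …, (i_n, s_n)` with `1 ≤ i_2 < ⋯ < i_n ≤ m` and
`0 ≤ s_j ≤ q_{i_j}`, together with the boundary conventions `i_1 = s_1 = 0`, `i_{n+1} = m + 1`,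
`s_{n+1} = 0`. The entry with index `j : Fin (n + 1)` is the pair `(i_{j+1}, s_{j+1})`. -/
structure SplittingPatterns {m : ℕ} (q : Fin m → ℝ) (n : ℕ) where
  /-- the positions `i_1, …, i_{n+1}` -/
  pos : Fin (n + 1) → ℕ
  /-- the split weights `s_1, …, s_{n+1}` -/
  split : Fin (n + 1) → ℝ
  pos_zero : pos 0 = 0
  pos_last : pos (Fin.last n) = m + 1
  pos_strictMono : StrictMono pos
  split_zero : split 0 = 0
  split_last : split (Fin.last n) = 0
  split_mem : ∀ j, split j ∈ Set.Icc 0 (labelled q (pos j))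

/-- `∑ j, p j • B(ε j)` is the channel `D_Q(i_2, …, i_n; s_2, …, s_n)` in `𝔹*_n` for
`Q = ∑ i, q i • B(σ i)` and the splitting patterns `T`: its `j`-th particle is compounded from the
`(i_j, i_{j+1}; s_j, s_{j+1})`-segment of `Q`. -/
structure IsSegmentCompound {m n : ℕ} (q : stdSimplex ℝ (Fin m)) (σ : Fin m → unitInterval)
    (T : SplittingPatterns q n) (p : stdSimplex ℝ (Fin n)) (ε : Fin n → unitInterval) : Prop where
  mem_star : bscMix p ε ∈ SymSetStar n
  compounded : ∀ j : Fin n, IsCompounded (p j) (ε j)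
    (Finset.Icc (T.pos j.castSucc) (T.pos j.succ))
    (segment q (T.pos j.castSucc) (T.pos j.succ) (T.split j.castSucc) (T.split j.succ))
    (labelled fun i => (σ i : ℝ))

end BIDMC

end

/-!
The Lorenz curve of `∑ i, q i • B(σ i)` with increasing `σ` maps a mass `x` to the least error
probability of a part of the channel of total mass `x`; it is convex and linear on the pieces
between its knots, the partial sums of `q`. Averaging the two rows of a degrading channel turns it
into a transport plan, so `∑ j, p j • B(ε j) ≼ ∑ i, q i • B(σ i)` holds if and only if the Lorenz
curve of `q`, `σ` lies below the one of `p`, `ε` at the knots of `p`.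

Inscribing a polygon in the Lorenz curve of `Q` therefore compounds neighbouring particles into a
degradation `D` of `Q` with the same error probability. The vertices of the polygon are the knots of
`W`, moved so that no piece of `Q` contains two of them except for both of its ends: two knots of
`W` in one piece are replaced by the ends of the piece, which the curve joins by a line. The polygon
still meets the Lorenz curve of `Q` at the knots of `W`, whence `W ≼ D`. By strict convexity between
pieces, the slope of a chord is a level `σ i` only if its cell is or contains the whole piece `i`.
-/

noncomputable section

namespace BIDMC

theorem IsDegradation.trans {W₁ W₂ W₃ : BIDMC} (h₁ : W₁.IsDegradation W₂)
    (h₂ : W₂.IsDegradation W₃) : W₁.IsDegradation W₃ := by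
  obtain ⟨K, hK⟩ := h₁
  obtain ⟨L, hL⟩ := h₂
  exact ⟨fun y => (L y).bind K, fun x => by rw [hK, hL, PMF.bind_bind]⟩

theorem IsDegradation.errorProb_le {W' W : BIDMC} (h : W'.IsDegradation W) :
    W.errorProb ≤ W'.errorProb := by
  obtain ⟨K, hK⟩ := h
  refine mul_le_mul_right (?_ : _ ≤ _) _
  calc ∑' y, min (W.law 0 y) (W.law 1 y)
      = ∑' y, ∑' z, min (W.law 0 y) (W.law 1 y) * K y z := by
        simp only [ENNReal.tsum_mul_left, PMF.tsum_coe, mul_one]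
    _ = ∑' z, ∑' y, min (W.law 0 y) (W.law 1 y) * K y z := ENNReal.tsum_comm
    _ ≤ ∑' z, min (W'.law 0 z) (W'.law 1 z) := by
        refine ENNReal.tsum_le_tsum fun z => ?_
        rw [hK, hK, PMF.bind_apply, PMF.bind_apply]
        refine le_min ?_ ?_ <;> refine ENNReal.tsum_le_tsum fun y => ?_ <;> gcongr
        exacts [min_le_left _ _, min_le_right _ _]

theorem strictMono_odds :
    StrictMono fun e : unitInterval => ENNReal.ofReal (e : ℝ) / ENNReal.ofReal (1 - (e : ℝ)) := by
  intro e e' (h : (e : ℝ) < e')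
  have he : (e : ℝ) < 1 := h.trans_le e'.2.2
  dsimp only
  rw [← ENNReal.ofReal_div_of_pos (sub_pos.2 he)]
  rcases e'.2.2.eq_or_lt with he' | he'
  · simp [he']
  · have he0 : 0 ≤ (e : ℝ) := e.2.1
    rw [← ENNReal.ofReal_div_of_pos (sub_pos.2 he'), ENNReal.ofReal_lt_ofReal_iff
      (div_pos (he0.trans_lt h) (sub_pos.2 he')), div_lt_div_iff₀ (sub_pos.2 he) (sub_pos.2 he')]
    linarith

/-- The probability of an output under the uniform input. -/
def mass (W : BIDMC) (y : W.Out) : ℝ≥0∞ := 2⁻¹ * (W.law 0 y + W.law 1 y)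

theorem two_mul_mass (W : BIDMC) (y : W.Out) : 2 * W.mass y = W.law 0 y + W.law 1 y := by
  rw [mass, ← mul_assoc, ENNReal.mul_inv_cancel (by simp) (by simp), one_mul]

theorem tsum_mass (W : BIDMC) : ∑' y, W.mass y = 1 := by
  simp only [mass]
  rw [ENNReal.tsum_mul_left, ENNReal.tsum_add, PMF.tsum_coe, PMF.tsum_coe, one_add_one_eq_two,
    ENNReal.inv_mul_cancel (by simp) (by simp)]

/-- The parameter `ε` for which the likelihood ratio of the output `y` is `ε / (1 - ε)`, i.e. the
posterior probability of the input `0`; it is `0` at outputs of probability zero. -/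
def lrParam (W : BIDMC) (y : W.Out) : unitInterval :=
  ⟨(W.law 0 y / (W.law 0 y + W.law 1 y)).toReal, ENNReal.toReal_nonneg,
    ENNReal.toReal_le_of_le_ofReal zero_le_one (by
      rw [ENNReal.ofReal_one]
      exact ENNReal.div_le_of_le_mul (by rw [one_mul]; exact le_self_add))⟩

/-- The posterior probability of the input `x` when the likelihood ratio is `e / (1 - e)`. -/
def posterior (x : ZMod 2) (e : unitInterval) : ℝ≥0∞ :=
  if x = 0 then ENNReal.ofReal (e : ℝ) else ENNReal.ofReal (1 - (e : ℝ))

theorem posterior_zero_add_posterior_one (e : unitInterval) :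
    posterior 0 e + posterior 1 e = 1 := by
  simp [posterior, ← ENNReal.ofReal_add e.2.1 (sub_nonneg.2 e.2.2)]

theorem law_eq (W : BIDMC) (x : ZMod 2) (y : W.Out) :
    W.law x y = 2 * W.mass y * posterior x (W.lrParam y) := by
  rw [two_mul_mass]
  rcases eq_or_ne (W.law 0 y + W.law 1 y) 0 with h | h
  · rw [h, zero_mul]
    rw [add_eq_zero] at h
    fin_cases x
    exacts [h.1, h.2]
  have ht : W.law 0 y + W.law 1 y ≠ ⊤ := by simp [PMF.apply_ne_top]
  have h0 : W.law 0 y = (W.law 0 y + W.law 1 y) * posterior 0 (W.lrParam y) := by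
    rw [posterior, if_pos rfl, lrParam, ENNReal.ofReal_toReal, ENNReal.mul_div_cancel h ht]
    exact (ENNReal.div_lt_top (PMF.apply_ne_top _ _) h).ne
  have h1 : W.law 1 y = (W.law 0 y + W.law 1 y) * posterior 1 (W.lrParam y) := by
    refine (ENNReal.add_right_inj (PMF.apply_ne_top (W.law 0) y)).1 ?_
    nth_rewrite 2 [h0]
    rw [← mul_add, posterior_zero_add_posterior_one, mul_one]
  fin_cases x
  exacts [h0, h1]

theorem mem_lrSet_iff {W : BIDMC} {y : W.Out} (hy : W.mass y ≠ 0) (e : unitInterval) :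
    y ∈ W.lrSet e ↔ W.lrParam y = e := by
  have ht : W.law 0 y + W.law 1 y ≠ ⊤ := by simp [PMF.apply_ne_top]
  have hodds : W.law 0 y / W.law 1 y =
      ENNReal.ofReal (W.lrParam y : ℝ) / ENNReal.ofReal (1 - (W.lrParam y : ℝ)) := by
    rw [W.law_eq 0 y, W.law_eq 1 y, ENNReal.mul_div_mul_left _ _ (by simpa using hy)
      (by rwa [two_mul_mass])]
    simp [posterior]
  exact (iff_of_eq (congrArg (· = _) hodds)).trans strictMono_odds.injective.eq_iff

theorem lrProfile_eq_tsum (W : BIDMC) (e : unitInterval) :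
    W.lrProfile e = ∑' y, (W.lrParam ⁻¹' {e}).indicator W.mass y := by
  refine (tsum_subtype (W.lrSet e) W.mass).trans (tsum_congr fun y => ?_)
  rcases eq_or_ne (W.mass y) 0 with hy | hy
  · rw [Set.indicator_apply_eq_zero.2 fun _ => hy, Set.indicator_apply_eq_zero.2 fun _ => hy]
  · classical
    rw [Set.indicator_apply, Set.indicator_apply]
    exact if_congr (mem_lrSet_iff hy e) rfl rfl

theorem lrProfile_ne_top (W : BIDMC) (e : unitInterval) : W.lrProfile e ≠ ⊤ := by
  refine ne_top_of_le_ne_top ENNReal.one_ne_top ?_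
  rw [lrProfile_eq_tsum, ← W.tsum_mass]
  exact ENNReal.tsum_le_tsum fun y => Set.indicator_le_self _ _ _

theorem mass_le_lrProfile (W : BIDMC) (y : W.Out) : W.mass y ≤ W.lrProfile (W.lrParam y) := by
  rw [lrProfile_eq_tsum]
  refine le_trans ?_ (ENNReal.le_tsum y)
  rw [Set.indicator_of_mem (Set.mem_preimage.2 (Set.mem_singleton _))]

open Classical in
/-- The output distribution of `W` conditioned on the likelihood ratio `e / (1 - e)`; it is an
arbitrary distribution when that likelihood ratio has probability zero. -/
def condLR (W : BIDMC) (e : unitInterval) : PMF W.Out :=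
  if h : W.lrProfile e = 0 then W.law 0 else
    PMF.normalize ((W.lrParam ⁻¹' {e}).indicator W.mass) (by rwa [← lrProfile_eq_tsum])
      (by rw [← lrProfile_eq_tsum]; exact W.lrProfile_ne_top e)

theorem condLR_apply {W : BIDMC} {e : unitInterval} (h : W.lrProfile e ≠ 0) (y : W.Out) :
    W.condLR e y = (W.lrParam ⁻¹' {e}).indicator W.mass y * (W.lrProfile e)⁻¹ := by
  rw [condLR, dif_neg h, PMF.normalize_apply, ← lrProfile_eq_tsum]

theorem Equivalent.law_mul_condLR {W W' : BIDMC} (h : W.Equivalent W') (x : ZMod 2) (y : W.Out)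
    (o : W'.Out) :
    W'.law x o * W.condLR (W'.lrParam o) y =
      (W'.lrParam ⁻¹' {W.lrParam y}).indicator W'.mass o *
        (W.law x y * (W.lrProfile (W.lrParam y))⁻¹) := by
  rcases eq_or_ne (W'.mass o) 0 with ho | ho
  · simp [W'.law_eq x o, ho, Set.indicator_apply_eq_zero.2]
  have hP : W.lrProfile (W'.lrParam o) ≠ 0 := by
    rw [h]
    exact (ho.bot_lt.trans_le (W'.mass_le_lrProfile o)).ne'
  rw [condLR_apply hP]
  by_cases hoy : W'.lrParam o = W.lrParam y
  · rw [Set.indicator_of_mem (s := W'.lrParam ⁻¹' _) hoy, hoy,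
      Set.indicator_of_mem (Set.mem_preimage.2 (Set.mem_singleton _)), W'.law_eq, W.law_eq, hoy]
    ring
  · rw [Set.indicator_of_notMem (s := W'.lrParam ⁻¹' _) hoy,
      Set.indicator_of_notMem (s := W.lrParam ⁻¹' _) (Ne.symm hoy : W.lrParam y ≠ _), zero_mul,
      zero_mul, mul_zero]

theorem Equivalent.isDegradation {W W' : BIDMC} (h : W.Equivalent W') : W.IsDegradation W' := by
  refine ⟨fun o => W.condLR (W'.lrParam o), fun x => PMF.ext fun y => ?_⟩
  rw [PMF.bind_apply, tsum_congr (h.law_mul_condLR x y), ENNReal.tsum_mul_right,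
    ← lrProfile_eq_tsum, ← h]
  rcases eq_or_ne (W.mass y) 0 with hy | hy
  · simp [W.law_eq x y, hy]
  · have hP : W.lrProfile (W.lrParam y) ≠ 0 := (hy.bot_lt.trans_le (W.mass_le_lrProfile y)).ne'
    rw [mul_left_comm, ENNReal.mul_inv_cancel hP (W.lrProfile_ne_top _), mul_one]

theorem Equivalent.symm {W W' : BIDMC} (h : W.Equivalent W') : W'.Equivalent W :=
  fun e => (h e).symm

theorem Equivalent.trans {W₁ W₂ W₃ : BIDMC} (h₁ : W₁.Equivalent W₂) (h₂ : W₂.Equivalent W₃) :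
    W₁.Equivalent W₃ :=
  fun e => (h₁ e).trans (h₂ e)

theorem Equivalent.errorProb_eq {W W' : BIDMC} (h : W.Equivalent W') :
    W.errorProb = W'.errorProb :=
  le_antisymm h.symm.isDegradation.errorProb_le h.isDegradation.errorProb_le

section Mixture

variable {n : ℕ}

theorem zmod_two_cases (b : ZMod 2) : b = 0 ∨ b = 1 := by
  revert b
  decide

theorem sum_zmod_two {M : Type*} [AddCommMonoid M] (f : ZMod 2 → M) : ∑ b, f b = f 0 + f 1 :=
  Fin.sum_univ_two f

/-- The output `b` of the `j`-th sub-channel of a mixture of binary symmetric channels. -/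
def mixOut (p : stdSimplex ℝ (Fin n)) (ε : Fin n → unitInterval) (j : Fin n) (b : ZMod 2) :
    (bscMix p ε).Out :=
  Sigma.mk (β := fun j => (bsc (ε j)).Out) j b

theorem exists_eq_mixOut {p : stdSimplex ℝ (Fin n)} {ε : Fin n → unitInterval}
    (o : (bscMix p ε).Out) : ∃ j b, o = mixOut p ε j b :=
  ⟨o.1, o.2, rfl⟩

theorem tsum_bscMix (p : stdSimplex ℝ (Fin n)) (ε : Fin n → unitInterval)
    (f : (bscMix p ε).Out → ℝ≥0∞) : ∑' o, f o = ∑ j, ∑ b, f (mixOut p ε j b) := by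
  refine (ENNReal.tsum_sigma' (β := fun _ : Fin n => ZMod 2) f).trans ?_
  simp only [tsum_fintype]
  rfl

/-- The transition probabilities, as real numbers, of the binary symmetric channel with crossover
probability `e`. -/
def flipProb (e : ℝ) (x b : ZMod 2) : ℝ := if b = x then 1 - e else e

theorem flipProb_nonneg (e : unitInterval) (x b : ZMod 2) : 0 ≤ flipProb e x b := by
  unfold flipProb
  split_ifs
  exacts [sub_nonneg.2 e.2.2, e.2.1]

theorem bsc_law (e : unitInterval) (x b : ZMod 2) :
    (bsc e).law x b = ENNReal.ofReal (flipProb e x b) := by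
  change (if b = x then _ else _) = _
  unfold flipProb
  split_ifs <;> rfl

theorem bscMix_law (p : stdSimplex ℝ (Fin n)) (ε : Fin n → unitInterval) (x : ZMod 2)
    (j : Fin n) (b : ZMod 2) :
    (bscMix p ε).law x (mixOut p ε j b) = ENNReal.ofReal (p j * flipProb (ε j) x b) := by
  change ((weightPMF p).bind fun i => ((bsc (ε i)).law x).map (Sigma.mk i))
    (Sigma.mk (β := fun j => (bsc (ε j)).Out) j b) = _
  have hother : ∀ i ≠ j, ((bsc (ε i)).law x).map (Sigma.mk i)
      (Sigma.mk (β := fun j => (bsc (ε j)).Out) j b) = 0 := by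
    intro i hi
    rw [PMF.map_apply, ENNReal.tsum_eq_zero]
    exact fun b' => if_neg fun h => hi (Sigma.mk.inj h).1.symm
  have hself : ((bsc (ε j)).law x).map (Sigma.mk j)
      (Sigma.mk (β := fun j => (bsc (ε j)).Out) j b) = (bsc (ε j)).law x b := by
    rw [PMF.map_apply]
    refine (tsum_eq_single (β := (bsc (ε j)).Out) b fun b' hb' => if_neg fun h => ?_).trans
      (if_pos rfl)
    exact hb' (eq_of_heq (Sigma.mk.inj h).2).symm
  rw [PMF.bind_apply, tsum_eq_single j fun i hi => by rw [hother i hi, mul_zero], hself, bsc_law]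
  exact (ENNReal.ofReal_mul (stdSimplex.zero_le p j)).symm

theorem bscMix_mass (p : stdSimplex ℝ (Fin n)) (ε : Fin n → unitInterval) (j : Fin n)
    (b : ZMod 2) : (bscMix p ε).mass (mixOut p ε j b) = ENNReal.ofReal (p j / 2) := by
  have hflip : ∀ x, 0 ≤ p j * flipProb (ε j) x b := fun x =>
    mul_nonneg (stdSimplex.zero_le p j) (flipProb_nonneg _ _ _)
  have hsum : flipProb (ε j) 0 b + flipProb (ε j) 1 b = 1 := by
    rcases zmod_two_cases b with rfl | rfl <;> simp [flipProb]
  rw [mass, bscMix_law, bscMix_law, ← ENNReal.ofReal_add (hflip 0) (hflip 1), ← mul_add, hsum,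
    mul_one, div_eq_inv_mul, ENNReal.ofReal_mul (by norm_num),
    ENNReal.ofReal_inv_of_pos (by norm_num), ENNReal.ofReal_ofNat]

theorem lrParam_mixOut {p : stdSimplex ℝ (Fin n)} (ε : Fin n → unitInterval) {j : Fin n}
    (hj : 0 < p j) (b : ZMod 2) :
    (bscMix p ε).lrParam (mixOut p ε j b) = if b = 0 then unitInterval.symm (ε j) else ε j := by
  have hmass : (bscMix p ε).mass (mixOut p ε j b) ≠ 0 := by
    simpa [bscMix_mass] using hj
  rw [← mem_lrSet_iff hmass]
  change (bscMix p ε).law 0 (mixOut p ε j b) / (bscMix p ε).law 1 (mixOut p ε j b) = _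
  rw [bscMix_law, bscMix_law, ENNReal.ofReal_mul hj.le, ENNReal.ofReal_mul hj.le,
    ENNReal.mul_div_mul_left _ _ (by simpa using hj) ENNReal.ofReal_ne_top]
  rcases zmod_two_cases b with rfl | rfl <;> simp [flipProb]

theorem bscMix_lrProfile (p : stdSimplex ℝ (Fin n)) (ε : Fin n → unitInterval)
    (e : unitInterval) :
    (bscMix p ε).lrProfile e =
      ∑ j, ((if unitInterval.symm (ε j) = e then ENNReal.ofReal (p j / 2) else 0) +
        (if ε j = e then ENNReal.ofReal (p j / 2) else 0)) := by
  have hind : ∀ j (b : ZMod 2), ((bscMix p ε).lrParam ⁻¹' {e}).indicator (bscMix p ε).mass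
      (mixOut p ε j b) = if (if b = 0 then unitInterval.symm (ε j) else ε j) = e then
        ENNReal.ofReal (p j / 2) else 0 := by
    classical
    intro j b
    rw [Set.indicator_apply, bscMix_mass]
    rcases (stdSimplex.zero_le p j).eq_or_lt with hj | hj
    · simp [show p j = 0 from hj.symm]
    · exact if_congr (by rw [Set.mem_preimage, lrParam_mixOut ε hj, Set.mem_singleton_iff]) rfl rfl
  simp only [lrProfile_eq_tsum, tsum_bscMix, hind, sum_zmod_two, if_true, if_neg one_ne_zero]

theorem bscMix_mem_symSet (p : stdSimplex ℝ (Fin n)) (ε : Fin n → unitInterval) :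
    bscMix p ε ∈ SymSet n := ⟨p, ε, fun _ => rfl⟩

theorem bscMix_equivalent_of_perm {p p' : stdSimplex ℝ (Fin n)} {ε ε' : Fin n → unitInterval}
    (s : Equiv.Perm (Fin n)) (hp : ∀ j, p' j = p (s j))
    (hε : ∀ j, ε' j = ε (s j) ∨ ε' j = unitInterval.symm (ε (s j))) :
    (bscMix p ε).Equivalent (bscMix p' ε') := by
  intro e
  rw [bscMix_lrProfile, bscMix_lrProfile, ← Equiv.sum_comp s]
  refine Finset.sum_congr rfl fun j _ => ?_
  rw [hp]
  rcases hε j with h | h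
  · rw [h]
  · rw [h, unitInterval.symm_symm, add_comm]

theorem exists_monotone_bscMix {W : BIDMC} (hW : W ∈ SymSet n) :
    ∃ (p : stdSimplex ℝ (Fin n)) (ε : Fin n → unitInterval),
      W.Equivalent (bscMix p ε) ∧ Monotone ε ∧ ∀ j, (ε j : ℝ) ≤ 1 / 2 := by
  obtain ⟨p, ε, h⟩ := hW
  let f : Fin n → unitInterval := fun j => min (ε j) (unitInterval.symm (ε j))
  let s := Tuple.sort f
  let p' : stdSimplex ℝ (Fin n) :=
    ⟨fun j => p (s j), fun j => stdSimplex.zero_le p _, (Equiv.sum_comp s fun j => p j).trans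
      (stdSimplex.sum_eq_one p)⟩
  refine ⟨p', f ∘ s, h.trans (bscMix_equivalent_of_perm s (fun _ => rfl) fun j => min_choice _ _),
    Tuple.monotone_sort f, fun j => ?_⟩
  have hle : (f (s j) : ℝ) ≤ ε (s j) := min_le_left _ _
  have hle_symm : (f (s j) : ℝ) ≤ 1 - ε (s j) :=
    min_le_right (ε (s j)) (unitInterval.symm (ε (s j)))
  change (f (s j) : ℝ) ≤ 1 / 2
  linarith

theorem bscMix_errorProb (p : stdSimplex ℝ (Fin n)) {ε : Fin n → unitInterval}
    (hε : ∀ j, (ε j : ℝ) ≤ 1 / 2) :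
    (bscMix p ε).errorProb = ENNReal.ofReal (∑ j, p j * ε j) := by
  have hmin : ∀ j, ∀ b : ZMod 2,
      min ((bscMix p ε).law 0 (mixOut p ε j b)) ((bscMix p ε).law 1 (mixOut p ε j b)) =
        ENNReal.ofReal (p j * ε j) := by
    intro j b
    have hle : p j * (ε j : ℝ) ≤ p j * (1 - ε j) :=
      mul_le_mul_of_nonneg_left (by linarith [hε j]) (stdSimplex.zero_le p j)
    rw [bscMix_law, bscMix_law]
    rcases zmod_two_cases b with rfl | rfl <;>
      simpa [flipProb] using ENNReal.ofReal_le_ofReal hle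
  rw [errorProb, tsum_bscMix]
  simp only [hmin, sum_zmod_two, ← two_mul]
  rw [← Finset.mul_sum, ← mul_assoc, ENNReal.inv_mul_cancel (by simp) (by simp), one_mul,
    ENNReal.ofReal_sum_of_nonneg fun j _ => mul_nonneg (stdSimplex.zero_le p j) (ε j).2.1]

theorem pos_of_mem_symSetStar {q : stdSimplex ℝ (Fin n)} {σ : Fin n → unitInterval}
    {Q : BIDMC} (hQ : Q.Equivalent (bscMix q σ)) (h : Q ∈ SymSetStar n) (i : Fin n) :
    0 < q i := by
  refine lt_of_le_of_ne (stdSimplex.zero_le q i) fun h0 => h.2 ?_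
  obtain ⟨k, rfl⟩ : ∃ k, n = k + 1 := ⟨n - 1, by have := i.2; omega⟩
  have hs : ∑ j : Fin k, q (i.succAbove j) = 1 := by
    have hsum := stdSimplex.sum_eq_one q
    rwa [Fin.sum_univ_succAbove _ i, ← h0, zero_add] at hsum
  refine ⟨⟨fun j => q (i.succAbove j), fun j => stdSimplex.zero_le q _, hs⟩,
    fun j => σ (i.succAbove j), hQ.trans fun e => ?_⟩
  rw [bscMix_lrProfile, bscMix_lrProfile, Fin.sum_univ_succAbove _ i, ← h0]
  simp only [zero_div, ENNReal.ofReal_zero, ite_self, add_zero, zero_add]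
  rfl

theorem bscMix_lrProfile_ne_zero {p : stdSimplex ℝ (Fin n)} (ε : Fin n → unitInterval) {j : Fin n}
    (hj : 0 < p j) : (bscMix p ε).lrProfile (ε j) ≠ 0 := by
  rw [bscMix_lrProfile, Ne, Finset.sum_eq_zero_iff, not_forall]
  exact ⟨j, by simpa using fun _ => hj⟩

theorem exists_min_symm_eq_of_lrProfile_ne_zero {p : stdSimplex ℝ (Fin n)}
    {ε : Fin n → unitInterval} {e : unitInterval} (he : (e : ℝ) ≤ 1 / 2)
    (h : (bscMix p ε).lrProfile e ≠ 0) : ∃ j, min (ε j) (unitInterval.symm (ε j)) = e := by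
  have hsymm : e ≤ unitInterval.symm e := by
    change (e : ℝ) ≤ 1 - e
    linarith
  rw [bscMix_lrProfile] at h
  obtain ⟨j, -, hj⟩ := Finset.exists_ne_zero_of_sum_ne_zero h
  refine ⟨j, ?_⟩
  by_cases hje : ε j = e
  · rw [hje, min_eq_left hsymm]
  · have hje' : unitInterval.symm (ε j) = e := by
      by_contra hne
      simp [hje, hne] at hj
    have hj_symm : ε j = unitInterval.symm e := by rw [← hje', unitInterval.symm_symm]
    rw [hj_symm, unitInterval.symm_symm, min_eq_right hsymm]

theorem bscMix_mem_symSetStar (hn : 0 < n) {p : stdSimplex ℝ (Fin n)} {ε : Fin n → unitInterval}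
    (hp : ∀ j, 0 < p j) (hε : StrictMono ε) (hhalf : ∀ j, (ε j : ℝ) ≤ 1 / 2) :
    bscMix p ε ∈ SymSetStar n := by
  refine ⟨bscMix_mem_symSet p ε, ?_⟩
  rintro ⟨p', ε', h⟩
  have hlevel : ∀ j, ∃ i, min (ε' i) (unitInterval.symm (ε' i)) = ε j := fun j =>
    exists_min_symm_eq_of_lrProfile_ne_zero (hhalf j) (h (ε j) ▸ bscMix_lrProfile_ne_zero ε (hp j))
  choose g hg using hlevel
  have hinj : Function.Injective g := fun a b hab => hε.injective (by rw [← hg a, ← hg b, hab])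
  have hcard := Fintype.card_le_of_injective g hinj
  simp only [Fintype.card_fin] at hcard
  omega

end Mixture

section Coupling

/-- `t` is a transport plan between the weights `p` and `q`: the amount `t j i` of the weight `q i`
is moved to `p j`. -/
structure IsTransport {ι κ : Type*} [Fintype ι] [Fintype κ] (p : ι → ℝ) (q : κ → ℝ)
    (t : ι → κ → ℝ) : Prop where
  nonneg : ∀ j i, 0 ≤ t j i
  sum_right : ∀ j, ∑ i, t j i = p j
  sum_left : ∀ i, ∑ j, t j i = q i

/-- `t` distributes the particles `q i • B(σ i)` over the particles `p j • B(ε j)` in such a way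
that the error probability of none of the latter is exceeded. This is the content of a degradation
between the two mixtures of binary symmetric channels, freed of all probabilistic data. -/
structure IsCoupling {ι κ : Type*} [Fintype ι] [Fintype κ] (p ε : ι → ℝ) (q σ : κ → ℝ)
    (t : ι → κ → ℝ) : Prop extends IsTransport p q t where
  sum_mul_le : ∀ j, ∑ i, t j i * σ i ≤ p j * ε j

variable {m n : ℕ} {p : stdSimplex ℝ (Fin n)} {q : stdSimplex ℝ (Fin m)}
  {ε : Fin n → unitInterval} {σ : Fin m → unitInterval}

theorem mul_flipProb_nonneg (p : stdSimplex ℝ (Fin n)) (ε : Fin n → unitInterval) (j : Fin n)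
    (x b : ZMod 2) : 0 ≤ p j * flipProb (ε j) x b :=
  mul_nonneg (stdSimplex.zero_le p j) (flipProb_nonneg _ _ _)

theorem exists_kernel_of_isDegradation (h : (bscMix p ε).IsDegradation (bscMix q σ)) :
    ∃ k : Fin m → ZMod 2 → Fin n → ZMod 2 → ℝ, (∀ i b j c, 0 ≤ k i b j c) ∧
      (∀ i b, ∑ j, ∑ c, k i b j c = 1) ∧
      ∀ x j c, p j * flipProb (ε j) x c = ∑ i, ∑ b, q i * flipProb (σ i) x b * k i b j c := by
  obtain ⟨K, hK⟩ := h
  refine ⟨fun i b j c => (K (mixOut q σ i b) (mixOut p ε j c)).toReal,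
    fun _ _ _ _ => ENNReal.toReal_nonneg, fun i b => ?_, fun x j c => ?_⟩
  · have hK_sum := (K (mixOut q σ i b)).tsum_coe
    rw [tsum_bscMix] at hK_sum
    simpa [ENNReal.toReal_sum, PMF.apply_ne_top, ENNReal.sum_eq_top] using
      congrArg ENNReal.toReal hK_sum
  · have hlaw := congrArg (fun f => (f (mixOut p ε j c)).toReal) (hK x)
    simpa [PMF.bind_apply, tsum_bscMix, bscMix_law, ENNReal.toReal_sum, PMF.apply_ne_top,
      ENNReal.sum_eq_top, ENNReal.mul_eq_top, ENNReal.toReal_mul, stdSimplex.zero_le,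
      flipProb_nonneg] using hlaw

-- The plan averages the transition probabilities over the two inputs and over the two outputs.
theorem exists_isCoupling_of_isDegradation (hσ : ∀ i, (σ i : ℝ) ≤ 1 / 2)
    (h : (bscMix p ε).IsDegradation (bscMix q σ)) :
    ∃ t, IsCoupling p (fun j => (ε j : ℝ)) q (fun i => (σ i : ℝ)) t := by
  obtain ⟨k, hk_nonneg, hk_sum, hlaw⟩ := exists_kernel_of_isDegradation h
  refine ⟨fun j i => q i / 2 * ∑ b, ∑ c, k i b j c, ⟨fun j i => ?_, fun j => ?_, fun i => ?_⟩,
    fun j => ?_⟩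
  · exact mul_nonneg (div_nonneg (stdSimplex.zero_le q i) zero_le_two)
      (Finset.sum_nonneg fun b _ => Finset.sum_nonneg fun c _ => hk_nonneg i b j c)
  · have hp : p j = (∑ x, ∑ c, p j * flipProb (ε j) x c) / 2 := by
      simp [sum_zmod_two, flipProb]
      ring
    rw [hp]
    simp only [hlaw, sum_zmod_two, ← Finset.sum_add_distrib, Finset.sum_div]
    refine Finset.sum_congr rfl fun i _ => ?_
    simp [flipProb]
    ring
  · rw [← Finset.mul_sum, Finset.sum_comm]
    simp only [hk_sum]
    rw [sum_zmod_two]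
    ring
  · have hpε : p j * (ε j : ℝ) = (p j * flipProb (ε j) 0 1 + p j * flipProb (ε j) 1 0) / 2 := by
      simp [flipProb]
    rw [hpε, hlaw, hlaw, ← Finset.sum_add_distrib, Finset.sum_div]
    refine Finset.sum_le_sum fun i _ => ?_
    have hcross : ∀ b c, 0 ≤ q i * k i b j c * (1 - 2 * σ i) := fun b c =>
      mul_nonneg (mul_nonneg (stdSimplex.zero_le q i) (hk_nonneg i b j c)) (by linarith [hσ i])
    simp [sum_zmod_two, flipProb]
    linarith [hcross 0 1, hcross 1 0]

theorem isDegradation_of_splitting (w : Fin m → stdSimplex ℝ (Fin n)) (δ : Fin n → unitInterval)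
    (h : ∀ x j c, p j * flipProb (ε j) x c =
      ∑ i, ∑ b, q i * flipProb (σ i) x b * (w i j * flipProb (δ j) b c)) :
    (bscMix p ε).IsDegradation (bscMix q σ) := by
  have hnonneg : ∀ x i b j c, 0 ≤ q i * flipProb (σ i) x b * (w i j * flipProb (δ j) b c) :=
    fun x i b j c => mul_nonneg (mul_flipProb_nonneg q σ i x b) (mul_flipProb_nonneg (w i) δ j b c)
  let K : (bscMix q σ).Out → PMF (bscMix p ε).Out := fun o => (bscMix (w o.1) δ).law o.2
  refine ⟨K, fun x => PMF.ext fun o => ?_⟩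
  obtain ⟨j, c, rfl⟩ := exists_eq_mixOut o
  rw [PMF.bind_apply, tsum_bscMix, bscMix_law, h,
    ENNReal.ofReal_sum_of_nonneg fun i _ => Finset.sum_nonneg fun b _ => hnonneg x i b j c]
  refine Finset.sum_congr rfl fun i _ => ?_
  rw [ENNReal.ofReal_sum_of_nonneg fun b _ => hnonneg x i b j c]
  refine Finset.sum_congr rfl fun b _ => ?_
  rw [ENNReal.ofReal_mul (mul_flipProb_nonneg q σ i x b), bscMix_law]
  exact congrArg _ (bscMix_law (w i) δ b j c).symm

theorem exists_noise {x y s : ℝ} (hxy : x ≤ y) (hy : y ≤ s / 2) :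
    ∃ δ : unitInterval, y = x * (1 - δ) + (s - x) * δ := by
  rcases eq_or_ne (s - 2 * x) 0 with h | h
  · exact ⟨0, by simp; linarith⟩
  · have hpos : 0 < s - 2 * x := lt_of_le_of_ne (by linarith) h.symm
    refine ⟨⟨(y - x) / (s - 2 * x), div_nonneg (by linarith) hpos.le,
      (div_le_one hpos).2 (by linarith)⟩, ?_⟩
    have hcancel := div_mul_cancel₀ (y - x) h
    change y = x * (1 - (y - x) / (s - 2 * x)) + (s - x) * ((y - x) / (s - 2 * x))
    linarith

theorem IsTransport.exists_splitting {q : Fin m → ℝ} {t : Fin n → Fin m → ℝ}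
    (h : IsTransport p q t) (i : Fin m) : ∃ w : stdSimplex ℝ (Fin n), ∀ j, q i * w j = t j i := by
  rcases eq_or_ne (q i) 0 with h0 | h0
  · have hsum := h.sum_left i
    rw [h0, Finset.sum_eq_zero_iff_of_nonneg fun j _ => h.nonneg j i] at hsum
    exact ⟨p, fun j => by rw [h0, zero_mul, hsum j (Finset.mem_univ j)]⟩
  · have hqi : 0 ≤ q i := h.sum_left i ▸ Finset.sum_nonneg fun j _ => h.nonneg j i
    refine ⟨⟨fun j => t j i / q i, fun j => div_nonneg (h.nonneg j i) hqi, ?_⟩,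
      fun j => mul_div_cancel₀ _ h0⟩
    rw [← Finset.sum_div, h.sum_left, div_self h0]

theorem IsCoupling.isDegradation (hε : ∀ j, (ε j : ℝ) ≤ 1 / 2) {t : Fin n → Fin m → ℝ}
    (h : IsCoupling p (fun j => (ε j : ℝ)) q (fun i => (σ i : ℝ)) t) :
    (bscMix p ε).IsDegradation (bscMix q σ) := by
  choose w hw using h.toIsTransport.exists_splitting
  have hnoise : ∀ j, ∃ δ : unitInterval, p j * (ε j : ℝ) =
      (∑ i, t j i * σ i) * (1 - δ) + (p j - ∑ i, t j i * σ i) * δ := fun j =>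
    exists_noise (h.sum_mul_le j) (by
      linarith [mul_le_mul_of_nonneg_left (hε j) (stdSimplex.zero_le p j)])
  choose δ hδ using hnoise
  refine isDegradation_of_splitting w δ fun x j c => ?_
  have hflip : ∀ b, ∑ i, t j i * flipProb (σ i) x b =
      if b = x then p j - ∑ i, t j i * σ i else ∑ i, t j i * σ i := by
    intro b
    unfold flipProb
    split_ifs
    · simp only [mul_sub, mul_one, Finset.sum_sub_distrib, h.sum_right]
    · rfl
  have hsplit : ∑ i, ∑ b, q i * flipProb (σ i) x b * (w i j * flipProb (δ j) b c) =
      ∑ b, (∑ i, t j i * flipProb (σ i) x b) * flipProb (δ j) b c := by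
    rw [Finset.sum_comm]
    refine Finset.sum_congr rfl fun b _ => ?_
    rw [Finset.sum_mul]
    refine Finset.sum_congr rfl fun i _ => ?_
    rw [← hw i j]
    ring
  rw [hsplit, sum_zmod_two, hflip, hflip]
  rcases zmod_two_cases x with rfl | rfl <;> rcases zmod_two_cases c with rfl | rfl <;>
    simp [flipProb] <;> linarith [hδ j]

end Coupling

section Exchange

/-- The change of a vector when the amount `δ` is moved from the entry `j` to the entry `i`. -/
def transfer {ι : Type*} [DecidableEq ι] (i j : ι) (δ : ℝ) : ι → ℝ :=
  Pi.single i δ - Pi.single j δ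

theorem transfer_left {ι : Type*} [DecidableEq ι] {i j : ι} (hij : i ≠ j) (δ : ℝ) :
    transfer i j δ i = δ := by
  simp [transfer, hij]

theorem transfer_right {ι : Type*} [DecidableEq ι] {i j : ι} (hij : i ≠ j) (δ : ℝ) :
    transfer i j δ j = -δ := by
  simp [transfer, hij.symm]

theorem transfer_of_ne {ι : Type*} [DecidableEq ι] {i j l : ι} (hi : l ≠ i) (hj : l ≠ j) (δ : ℝ) :
    transfer i j δ l = 0 := by
  simp [transfer, hi, hj]

theorem transfer_one_mul {ι : Type*} [DecidableEq ι] (i j l : ι) (δ : ℝ) :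
    transfer i j 1 l * δ = transfer i j δ l := by
  simp [transfer, Pi.single_apply, sub_mul]

variable {ι κ : Type*} [Fintype ι] [Fintype κ] {p e : ι → ℝ} {r h : κ → ℝ} {t : ι → κ → ℝ}

theorem IsTransport.weight_nonneg (ht : IsTransport p r t) (j : ι) : 0 ≤ p j :=
  ht.sum_right j ▸ Finset.sum_nonneg fun c _ => ht.nonneg j c

theorem IsTransport.eq_zero (ht : IsTransport p r t) {j : ι} (hj : p j = 0) (c : κ) : t j c = 0 :=
  (Finset.sum_eq_zero_iff_of_nonneg fun c _ => ht.nonneg j c).1 ((ht.sum_right j).trans hj) c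
    (Finset.mem_univ c)

theorem IsTransport.add_exchange [DecidableEq ι] (ht : IsTransport p r t) {i j : ι} (hij : i ≠ j)
    {θ : ℝ} (hθ : 0 ≤ θ) (hθ_le : θ * (p i + p j) ≤ 1) :
    IsTransport p r fun l c => t l c +
      transfer i j 1 l * (θ * (p i * t j c - p j * t i c)) where
  nonneg l c := by
    have hpi := ht.weight_nonneg i
    have hpj := ht.weight_nonneg j
    have hti := ht.nonneg i c
    have htj := ht.nonneg j c
    rcases eq_or_ne l i with rfl | hli
    · have : 0 ≤ (1 - θ * (p l + p j)) * t l c := mul_nonneg (sub_nonneg.2 hθ_le) hti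
      have : 0 ≤ θ * p l * (t l c + t j c) := by positivity
      rw [transfer_left hij]
      linarith
    rcases eq_or_ne l j with rfl | hlj
    · have : 0 ≤ (1 - θ * (p i + p l)) * t l c := mul_nonneg (sub_nonneg.2 hθ_le) htj
      have : 0 ≤ θ * p l * (t i c + t l c) := by positivity
      rw [transfer_right hij]
      linarith
    · simpa [transfer_of_ne hli hlj] using ht.nonneg l c
  sum_right l := by
    rw [Finset.sum_add_distrib, ht.sum_right, ← Finset.mul_sum, ← Finset.mul_sum,
      Finset.sum_sub_distrib, ← Finset.mul_sum, ← Finset.mul_sum, ht.sum_right, ht.sum_right]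
    ring
  sum_left c := by
    rw [Finset.sum_add_distrib, ht.sum_left, ← Finset.sum_mul]
    simp [transfer]

theorem IsTransport.exists_exchange [DecidableEq ι] (ht : IsTransport p r t) (h : κ → ℝ) {i j : ι}
    (hij : i ≠ j) {x δ : ℝ} (hδ : 0 < δ) (hi : ∑ c, t i c * h c + δ ≤ p i * x)
    (hj : p j * x ≤ ∑ c, t j c * h c - δ) :
    ∃ t', IsTransport p r t' ∧
      ∀ l, ∑ c, t' l c * h c = ∑ c, t l c * h c + transfer i j δ l := by
  have hpi := ht.weight_nonneg i
  have hpj := ht.weight_nonneg j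
  have hpos : 0 < p i + p j := by
    by_contra! hle
    have hpi0 : p i = 0 := by linarith
    simp only [ht.eq_zero hpi0, hpi0, zero_mul, Finset.sum_const_zero] at hi
    linarith
  set D := p i * ∑ c, t j c * h c - p j * ∑ c, t i c * h c with hD
  have hD_ge : δ * (p i + p j) ≤ D := by
    linarith [mul_le_mul_of_nonneg_left hi hpj, mul_le_mul_of_nonneg_left hj hpi]
  have hD_pos : 0 < D := (mul_pos hδ hpos).trans_le hD_ge
  refine ⟨_, ht.add_exchange hij (θ := δ / D) (by positivity) ?_, fun l => ?_⟩
  · rwa [div_mul_eq_mul_div, div_le_one hD_pos]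
  · have hsum : ∑ c, δ / D * (p i * t j c - p j * t i c) * h c = δ := by
      simp only [mul_assoc, ← Finset.mul_sum, sub_mul, Finset.sum_sub_distrib, ← hD]
      exact div_mul_cancel₀ δ hD_pos.ne'
    simp only [add_mul, mul_assoc (transfer i j 1 l), Finset.sum_add_distrib, ← Finset.mul_sum]
    rw [hsum, transfer_one_mul]

theorem exists_neg_lt_pos_of_sum_nonpos [LinearOrder ι] {d : ι → ℝ}
    (hd : ∀ k, ∑ j with j ≤ k, d j ≤ 0) (hpos : ∃ j, 0 < d j) :
    ∃ i j, i < j ∧ d i < 0 ∧ 0 < d j ∧ ∀ l < j, d l ≤ 0 := by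
  obtain ⟨j, hj⟩ := (Set.toFinite {j | 0 < d j}).exists_minimal hpos
  have hbelow : ∀ l < j, d l ≤ 0 := fun l hl => not_lt.1 fun h => hl.not_ge (hj.2 h hl.le)
  obtain ⟨i, hij, hi⟩ : ∃ i < j, d i < 0 := by
    by_contra! hnonneg
    refine (hd j).not_gt ?_
    refine lt_of_lt_of_le hj.1 (Finset.single_le_sum (f := d) (fun l hl => ?_) (by simp))
    rcases (Finset.mem_filter.1 hl).2.eq_or_lt with rfl | hlt
    exacts [hj.1.le, hnonneg l hlt]
  exact ⟨i, j, hij, hi, hj.1, hbelow⟩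

theorem sum_add_transfer_nonpos [LinearOrder ι] {d : ι → ℝ} (hd : ∀ k, ∑ j with j ≤ k, d j ≤ 0)
    {i j : ι} (hij : i < j) (hbelow : ∀ l < j, d l ≤ 0) {δ : ℝ} (hδ : δ ≤ -d i) (k : ι) :
    ∑ l with l ≤ k, (d l + transfer i j δ l) ≤ 0 := by
  rcases le_or_gt j k with hjk | hkj
  · rw [Finset.sum_add_distrib]
    simpa [transfer, Finset.sum_pi_single, hjk, hij.le.trans hjk] using hd k
  · refine Finset.sum_nonpos fun l hl => ?_
    have hlj : l < j := (Finset.mem_filter.1 hl).2.trans_lt hkj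
    rcases eq_or_ne l i with rfl | hli
    · rw [transfer_left hij.ne]
      linarith
    · rw [transfer_of_ne hli hlj.ne, add_zero]
      exact hbelow l hlj

theorem card_support_add_transfer_lt [DecidableEq ι] {d : ι → ℝ} {i j : ι} (hij : i ≠ j)
    (hi : d i ≠ 0) (hj : d j ≠ 0) {δ : ℝ} (hδ : δ = -d i ∨ δ = d j) :
    Finset.card {l | d l + transfer i j δ l ≠ 0} < Finset.card {l | d l ≠ 0} := by
  refine Finset.card_lt_card (Finset.ssubset_iff_of_subset (fun l hl => ?_) |>.2 ?_)
  · rw [Finset.mem_filter_univ] at hl ⊢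
    rcases eq_or_ne l i with rfl | hli
    · exact hi
    rcases eq_or_ne l j with rfl | hlj
    · exact hj
    · simpa [transfer_of_ne hli hlj] using hl
  · rcases hδ with rfl | rfl
    · exact ⟨i, by simpa using hi, by simp [transfer_left hij]⟩
    · exact ⟨j, by simpa using hj, by simp [transfer_right hij]⟩

-- As long as some target receives too much error probability, an earlier one receives too little;
-- mixing the mass of the two removes one of the deviations.
theorem IsTransport.exists_isCoupling [LinearOrder ι] (he : Monotone e) (ht : IsTransport p r t)
    {d : ι → ℝ} (hd : ∀ j, ∑ c, t j c * h c = p j * e j + d j)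
    (hsum : ∀ k, ∑ j with j ≤ k, d j ≤ 0) : ∃ M, IsCoupling p e r h M := by
  induction hcard : Finset.card {l | d l ≠ 0} using Nat.strong_induction_on generalizing t d with
  | _ k ih =>
  by_cases hpos : ∃ j, 0 < d j
  · obtain ⟨i, j, hij, hi, hj, hbelow⟩ := exists_neg_lt_pos_of_sum_nonpos hsum hpos
    set δ := min (-d i) (d j)
    have hδi : δ ≤ -d i := min_le_left _ _
    have hδj : δ ≤ d j := min_le_right _ _
    have hei : p i * e i ≤ p i * e j := mul_le_mul_of_nonneg_left (he hij.le) (ht.weight_nonneg i)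
    obtain ⟨t', ht', hmoment⟩ := ht.exists_exchange h hij.ne (x := e j) (δ := δ)
      (lt_min (by linarith) hj) (by linarith [hd i]) (by linarith [hd j])
    refine ih _ ?_ ht' (d := fun l => d l + transfer i j δ l)
      (fun l => by rw [hmoment, hd, add_assoc]) (sum_add_transfer_nonpos hsum hij hbelow hδi) rfl
    exact hcard ▸ card_support_add_transfer_lt hij.ne hi.ne hj.ne' (min_choice _ _)
  · exact ⟨t, ht, fun j => by linarith [hd j, not_lt.1 fun h => hpos ⟨j, h⟩]⟩

end Exchange

section Lorenz

variable {m n : ℕ} {q σ : Fin m → ℝ}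

/-- The mass of the first `k` particles. The piece of the particle `i` is the interval from
`knot q i` to `knot q (i + 1)`; for `m ≤ k` the value is the total mass. -/
def knot (q : Fin m → ℝ) (k : ℕ) : ℝ := ∑ i : Fin m with i.val < k, q i

theorem knot_zero (q : Fin m → ℝ) : knot q 0 = 0 := by
  simp [knot]

theorem knot_succ (q : Fin m → ℝ) (i : Fin m) : knot q (i + 1) = knot q i + q i := by
  have h : Finset.univ.filter (fun l : Fin m => l.val < i + 1) =
      insert i (Finset.univ.filter fun l : Fin m => l.val < i) := by
    ext l
    simp only [Finset.mem_filter_univ, Finset.mem_insert, Fin.ext_iff]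
    omega
  rw [knot, h, Finset.sum_insert (by simp), add_comm, knot]

theorem knot_of_le (q : Fin m → ℝ) {k : ℕ} (hk : m ≤ k) : knot q k = ∑ i, q i := by
  simp [knot, fun i : Fin m => i.2.trans_le hk]

theorem sum_filter_le_eq_knot (q : Fin m → ℝ) (i : Fin m) :
    ∑ l with l ≤ i, q l = knot q (i + 1) := by
  simp only [knot, Order.lt_add_one_iff, Fin.val_fin_le]

theorem knot_sub_eq (f : ℕ → ℝ) {k : ℕ} (hk : k ≤ m) :
    knot (fun i : Fin m => f (i + 1) - f i) k = f k - f 0 := by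
  induction k with
  | zero => rw [knot_zero, sub_self]
  | succ k ih =>
    rw [knot_succ _ ⟨k, hk⟩, ih (by omega)]
    ring

theorem knot_mono (hq : ∀ i, 0 ≤ q i) : Monotone (knot q) := fun _ _ hab =>
  Finset.sum_le_sum_of_subset_of_nonneg
    (Finset.monotone_filter_right _ fun _ _ h => h.trans_le hab) fun i _ _ => hq i

theorem knot_strictMonoOn (hq : ∀ i, 0 < q i) : StrictMonoOn (knot q) (Set.Iic m) :=
  fun a _ b hb hab => by
    have h := knot_succ q ⟨a, hab.trans_le hb⟩
    have hsucc := knot_mono (fun i => (hq i).le) (Nat.succ_le_of_lt hab)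
    linarith [hq ⟨a, hab.trans_le hb⟩]

theorem knot_nonneg (hq : ∀ i, 0 ≤ q i) (k : ℕ) : 0 ≤ knot q k :=
  Finset.sum_nonneg fun i _ => hq i

theorem knot_le_sum (hq : ∀ i, 0 ≤ q i) (k : ℕ) : knot q k ≤ ∑ i, q i :=
  Finset.sum_le_sum_of_subset_of_nonneg (Finset.filter_subset _ _) fun i _ _ => hq i

theorem exists_knot_lt_le {x : ℝ} (hx : 0 < x) (hx_le : x ≤ ∑ i, q i) :
    ∃ i : Fin m, knot q i < x ∧ x ≤ knot q (i + 1) := by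
  classical
  have hex : ∃ k, x ≤ knot q k := ⟨m, hx_le.trans_eq (knot_of_le q le_rfl).symm⟩
  obtain ⟨k, hk⟩ : ∃ k, Nat.find hex = k + 1 := Nat.exists_eq_succ_of_ne_zero fun h0 =>
    hx.not_ge ((Nat.find_eq_zero hex).1 h0 |>.trans_eq (knot_zero q))
  have hkm : Nat.find hex ≤ m := Nat.find_min' hex (hx_le.trans_eq (knot_of_le q le_rfl).symm)
  exact ⟨⟨k, by omega⟩, not_le.1 (Nat.find_min hex (by simp [hk])), hk ▸ Nat.find_spec hex⟩

/-- The part below `x` of the interval from `S l` to `S (l + 1)`, measured by its length. -/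
def overlap (S : ℕ → ℝ) (x : ℝ) (l : ℕ) : ℝ := min x (S (l + 1)) - min x (S l)

theorem overlap_mono {S : ℕ → ℝ} (hS : Monotone S) {x y : ℝ} (hxy : x ≤ y) (l : ℕ) :
    overlap S x l ≤ overlap S y l := by
  have hstep := hS (Nat.le_succ l)
  simp only [overlap]
  grind

theorem overlap_of_le {S : ℕ → ℝ} (hS : Monotone S) {x : ℝ} {l : ℕ} (h : x ≤ S l) :
    overlap S x l = 0 := by
  rw [overlap, min_eq_left h, min_eq_left (h.trans (hS (Nat.le_succ l))), sub_self]

theorem overlap_of_ge {S : ℕ → ℝ} (hS : Monotone S) {x : ℝ} {l : ℕ} (h : S (l + 1) ≤ x) :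
    overlap S x l = S (l + 1) - S l := by
  rw [overlap, min_eq_right h, min_eq_right ((hS (Nat.le_succ l)).trans h)]

theorem overlap_of_mem {S : ℕ → ℝ} {x : ℝ} {l : ℕ} (h : S l ≤ x) (h' : x ≤ S (l + 1)) :
    overlap S x l = x - S l := by
  rw [overlap, min_eq_left h', min_eq_right h]

theorem sum_overlap_knot {x : ℝ} (hx : x ∈ Set.Icc 0 (∑ i, q i)) :
    ∑ i : Fin m, overlap (knot q) x i = x := by
  rw [Fin.sum_univ_eq_sum_range (overlap (knot q) x)]
  refine (Finset.sum_range_sub (fun l => min x (knot q l)) m).trans ?_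
  rw [knot_of_le q le_rfl, knot_zero, min_eq_left hx.2, min_eq_right hx.1, sub_zero]

/-- The Lorenz curve of the particles `q i • B(σ i)`: the least error probability of a part of
total mass `x`, which for increasing levels `σ` is formed by the first particles. -/
def lorenz (q σ : Fin m → ℝ) (x : ℝ) : ℝ := ∑ i : Fin m, σ i * overlap (knot q) x i

theorem lorenz_sub (q σ : Fin m → ℝ) (x y : ℝ) :
    lorenz q σ y - lorenz q σ x =
      ∑ i : Fin m, σ i * (overlap (knot q) y i - overlap (knot q) x i) := by
  simp only [lorenz, mul_sub, Finset.sum_sub_distrib]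

theorem lorenz_knot (hq : ∀ i, 0 ≤ q i) (σ : Fin m → ℝ) (k : ℕ) :
    lorenz q σ (knot q k) = knot (fun i => q i * σ i) k := by
  rw [lorenz, knot.eq_def (fun i => q i * σ i), Finset.sum_filter]
  refine Finset.sum_congr rfl fun i _ => ?_
  split_ifs with h
  · rw [overlap_of_ge (knot_mono hq) (knot_mono hq h), knot_succ, add_sub_cancel_left, mul_comm]
  · rw [overlap_of_le (knot_mono hq) (knot_mono hq (not_lt.1 h)), mul_zero]

theorem lorenz_zero (hq : ∀ i, 0 ≤ q i) (σ : Fin m → ℝ) : lorenz q σ 0 = 0 := by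
  simpa only [knot_zero] using lorenz_knot hq σ 0

theorem sum_mul_sub_overlap {s x y : ℝ} (hx : x ∈ Set.Icc 0 (∑ i, q i))
    (hy : y ∈ Set.Icc 0 (∑ i, q i)) :
    ∑ i : Fin m, s * (overlap (knot q) y i - overlap (knot q) x i) = s * (y - x) := by
  rw [← Finset.mul_sum, Finset.sum_sub_distrib, sum_overlap_knot hx, sum_overlap_knot hy]

theorem lorenz_sub_mem_Icc {a b : ℝ} (hq : ∀ i, 0 ≤ q i) (hσ : ∀ i, σ i ∈ Set.Icc a b) {x y : ℝ}
    (hx : 0 ≤ x) (hxy : x ≤ y) (hy : y ≤ ∑ i, q i) :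
    lorenz q σ y - lorenz q σ x ∈ Set.Icc (a * (y - x)) (b * (y - x)) := by
  have hx' : x ∈ Set.Icc 0 (∑ i, q i) := ⟨hx, hxy.trans hy⟩
  have hy' : y ∈ Set.Icc 0 (∑ i, q i) := ⟨hx.trans hxy, hy⟩
  rw [lorenz_sub, ← sum_mul_sub_overlap hx' hy', ← sum_mul_sub_overlap hx' hy']
  have hnonneg (i : Fin m) := sub_nonneg.2 (overlap_mono (knot_mono hq) hxy i)
  exact ⟨Finset.sum_le_sum fun i _ => mul_le_mul_of_nonneg_right (hσ i).1 (hnonneg i),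
    Finset.sum_le_sum fun i _ => mul_le_mul_of_nonneg_right (hσ i).2 (hnonneg i)⟩

theorem lorenz_sub_le (hq : ∀ i, 0 ≤ q i) (hσ : Monotone σ) {i : Fin m} {x y : ℝ} (hx : 0 ≤ x)
    (hxy : x ≤ y) (hy : y ≤ knot q (i + 1)) :
    lorenz q σ y - lorenz q σ x ≤ σ i * (y - x) := by
  have hy' := hy.trans (knot_le_sum hq _)
  rw [lorenz_sub, ← sum_mul_sub_overlap ⟨hx, hxy.trans hy'⟩ ⟨hx.trans hxy, hy'⟩]
  refine Finset.sum_le_sum fun l _ => ?_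
  rcases le_or_gt l i with hl | hl
  · exact mul_le_mul_of_nonneg_right (hσ hl) (sub_nonneg.2 (overlap_mono (knot_mono hq) hxy l))
  · have hyl : y ≤ knot q l := hy.trans (knot_mono hq hl)
    rw [overlap_of_le (knot_mono hq) hyl, overlap_of_le (knot_mono hq) (hxy.trans hyl), sub_zero,
      mul_zero, mul_zero]

theorem le_lorenz_sub (hq : ∀ i, 0 ≤ q i) (hσ : Monotone σ) {i : Fin m} {x y : ℝ}
    (hx : knot q i ≤ x) (hxy : x ≤ y) (hy : y ≤ ∑ i, q i) :
    σ i * (y - x) ≤ lorenz q σ y - lorenz q σ x := by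
  have hx' := (knot_nonneg hq _).trans hx
  rw [lorenz_sub, ← sum_mul_sub_overlap ⟨hx', hxy.trans hy⟩ ⟨hx'.trans hxy, hy⟩]
  refine Finset.sum_le_sum fun l _ => ?_
  rcases le_or_gt i l with hl | hl
  · exact mul_le_mul_of_nonneg_right (hσ hl) (sub_nonneg.2 (overlap_mono (knot_mono hq) hxy l))
  · have hlx : knot q (l + 1) ≤ x := (knot_mono hq hl).trans hx
    rw [overlap_of_ge (knot_mono hq) hlx, overlap_of_ge (knot_mono hq) (hlx.trans hxy), sub_self,
      mul_zero, mul_zero]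

theorem lorenz_sub_eq (hq : ∀ i, 0 ≤ q i) (hσ : Monotone σ) {i : Fin m} {x y : ℝ}
    (hx : knot q i ≤ x) (hxy : x ≤ y) (hy : y ≤ knot q (i + 1)) :
    lorenz q σ y - lorenz q σ x = σ i * (y - x) :=
  (lorenz_sub_le hq hσ ((knot_nonneg hq _).trans hx) hxy hy).antisymm
    (le_lorenz_sub hq hσ hx hxy (hy.trans (knot_le_sum hq _)))

theorem knot_le_of_le_lorenz_sub (hq : ∀ i, 0 ≤ q i) (hσ : StrictMono σ) {i : Fin m} {x y : ℝ}
    (hx : 0 ≤ x) (hxy : x < y) (hy : y ≤ knot q (i + 1))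
    (h : σ i * (y - x) ≤ lorenz q σ y - lorenz q σ x) : knot q i ≤ x := by
  by_contra! hlt
  obtain ⟨l, hl⟩ : ∃ l, (i : ℕ) = l + 1 := Nat.exists_eq_succ_of_ne_zero fun h0 =>
    hlt.not_ge (h0 ▸ (knot_zero q).trans_le hx)
  let l' : Fin m := ⟨l, by omega⟩
  have hσl : σ l' < σ i := hσ (Fin.lt_def.2 (by simp [l', hl]))
  set z := min y (knot q i)
  have hxz : x < z := lt_min hxy hlt
  have hzy : z ≤ y := min_le_left _ _
  have hlow : lorenz q σ z - lorenz q σ x ≤ σ l' * (z - x) :=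
    lorenz_sub_le hq hσ.monotone hx hxz.le ((min_le_right _ _).trans_eq (by rw [hl]))
  have hhigh : lorenz q σ y - lorenz q σ z ≤ σ i * (y - z) :=
    lorenz_sub_le hq hσ.monotone (hx.trans hxz.le) hzy hy
  linarith [mul_lt_mul_of_pos_right hσl (sub_pos.2 hxz)]

theorem le_knot_of_lorenz_sub_le (hq : ∀ i, 0 ≤ q i) (hσ : StrictMono σ) {i : Fin m} {x y : ℝ}
    (hx : knot q i ≤ x) (hxy : x < y) (hy : y ≤ ∑ i, q i)
    (h : lorenz q σ y - lorenz q σ x ≤ σ i * (y - x)) : y ≤ knot q (i + 1) := by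
  by_contra! hlt
  have hi : (i : ℕ) + 1 < m := by
    by_contra! hle
    exact hlt.not_ge (hy.trans_eq (knot_of_le q hle).symm)
  let i' : Fin m := ⟨i + 1, hi⟩
  have hσi : σ i < σ i' := hσ (Fin.lt_def.2 (Nat.lt_succ_self _))
  set z := max x (knot q (i + 1))
  have hzy : z < y := max_lt hxy hlt
  have hxz : x ≤ z := le_max_left _ _
  have hhigh : σ i' * (y - z) ≤ lorenz q σ y - lorenz q σ z :=
    le_lorenz_sub hq hσ.monotone (le_max_right x (knot q (i + 1))) hzy.le hy
  have hlow : σ i * (z - x) ≤ lorenz q σ z - lorenz q σ x :=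
    le_lorenz_sub hq hσ.monotone hx hxz (hzy.le.trans hy)
  linarith [mul_lt_mul_of_pos_right hσi (sub_pos.2 hzy)]

theorem lorenz_le_sum_mul (hσ : Monotone σ) {τ : Fin m → ℝ} (hτ : ∀ i, 0 ≤ τ i)
    (hτq : ∀ i, τ i ≤ q i) : lorenz q σ (∑ i, τ i) ≤ ∑ i, σ i * τ i := by
  have hq : ∀ i, 0 ≤ q i := fun i => (hτ i).trans (hτq i)
  have hS := knot_mono hq
  set x := ∑ i, τ i with hx
  have hx_mem : x ∈ Set.Icc 0 (∑ i, q i) :=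
    ⟨Finset.sum_nonneg fun i _ => hτ i, Finset.sum_le_sum fun i _ => hτq i⟩
  rcases hx_mem.1.eq_or_lt with hx0 | hx0
  · have hτ0 : ∀ i, τ i = 0 := fun i =>
      (Finset.sum_eq_zero_iff_of_nonneg fun i _ => hτ i).1 hx0.symm i (Finset.mem_univ i)
    rw [← hx0, lorenz_zero hq]
    simp [hτ0]
  obtain ⟨k, hk, hk'⟩ := exists_knot_lt_le hx0 hx_mem.2
  have hterm : ∀ i : Fin m, 0 ≤ (σ i - σ k) * (τ i - overlap (knot q) x i) := by
    intro i
    rcases lt_trichotomy i k with h | rfl | h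
    · rw [overlap_of_ge hS ((hS h).trans hk.le), knot_succ, add_sub_cancel_left]
      exact mul_nonneg_of_nonpos_of_nonpos (sub_nonpos.2 (hσ h.le)) (sub_nonpos.2 (hτq i))
    · rw [sub_self, zero_mul]
    · rw [overlap_of_le hS (hk'.trans (hS h)), sub_zero]
      exact mul_nonneg (sub_nonneg.2 (hσ h.le)) (hτ i)
  have hsum : ∑ i : Fin m, (σ i - σ k) * (τ i - overlap (knot q) x i) =
      ∑ i, σ i * τ i - lorenz q σ x := by
    simp only [sub_mul, mul_sub, Finset.sum_sub_distrib, ← Finset.mul_sum, sum_overlap_knot hx_mem,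
      ← hx, lorenz, sub_sub_sub_cancel_right]
  linarith [Finset.sum_nonneg fun i (_ : i ∈ Finset.univ) => hterm i]

variable {p ε : Fin n → ℝ} {t : Fin n → Fin m → ℝ}

theorem IsCoupling.lorenz_le (ht : IsCoupling p ε q σ t) (hσ : Monotone σ) (k : ℕ) :
    lorenz q σ (knot p k) ≤ lorenz p ε (knot p k) := by
  set τ : Fin m → ℝ := fun i => ∑ j : Fin n with j.val < k, t j i
  have hτ_sum : ∑ i, τ i = knot p k := by
    rw [Finset.sum_comm]
    exact Finset.sum_congr rfl fun j _ => ht.sum_right j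
  have hτ_le (i : Fin m) : τ i ≤ q i :=
    (Finset.sum_le_sum_of_subset_of_nonneg (Finset.filter_subset _ _)
      fun j _ _ => ht.nonneg j i).trans_eq (ht.sum_left i)
  calc lorenz q σ (knot p k) ≤ ∑ i, σ i * τ i :=
        hτ_sum ▸ lorenz_le_sum_mul hσ (fun i => Finset.sum_nonneg fun j _ => ht.nonneg j i) hτ_le
    _ = ∑ j : Fin n with j.val < k, ∑ i, t j i * σ i := by
        rw [Finset.sum_comm]
        simp only [τ, Finset.mul_sum, mul_comm]
    _ ≤ ∑ j : Fin n with j.val < k, p j * ε j := Finset.sum_le_sum fun j _ => ht.sum_mul_le j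
    _ = lorenz p ε (knot p k) := (lorenz_knot ht.weight_nonneg ε k).symm

theorem isTransport_overlap_sub (hp : ∀ j, 0 ≤ p j) (hq : ∀ i, 0 ≤ q i)
    (hpq : ∑ j, p j = ∑ i, q i) :
    IsTransport p q fun j i => overlap (knot q) (knot p (j + 1)) i - overlap (knot q) (knot p j) i
    where
  nonneg j i := sub_nonneg.2 (overlap_mono (knot_mono hq) (knot_mono hp (Nat.le_succ _)) i)
  sum_right j := by
    have hmem (k : ℕ) : knot p k ∈ Set.Icc 0 (∑ i, q i) :=
      ⟨knot_nonneg hp k, hpq ▸ knot_le_sum hp k⟩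
    rw [Finset.sum_sub_distrib, sum_overlap_knot (hmem _), sum_overlap_knot (hmem _), knot_succ,
      add_sub_cancel_left]
  sum_left i := by
    rw [Fin.sum_univ_eq_sum_range
        fun l => overlap (knot q) (knot p (l + 1)) i - overlap (knot q) (knot p l) i,
      Finset.sum_range_sub (fun l => overlap (knot q) (knot p l) i), knot_zero,
      knot_of_le p le_rfl, overlap_of_le (knot_mono hq) (knot_nonneg hq _), sub_zero,
      overlap_of_ge (knot_mono hq) ((knot_le_sum hq _).trans hpq.ge), knot_succ,
      add_sub_cancel_left]

theorem exists_isCoupling_of_lorenz_le (hp : ∀ j, 0 ≤ p j) (hq : ∀ i, 0 ≤ q i)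
    (hpq : ∑ j, p j = ∑ i, q i) (hε : Monotone ε)
    (h : ∀ k ≤ n, lorenz q σ (knot p k) ≤ lorenz p ε (knot p k)) : ∃ t, IsCoupling p ε q σ t := by
  refine (isTransport_overlap_sub hp hq hpq).exists_isCoupling hε
    (d := fun j => lorenz q σ (knot p (j + 1)) - lorenz q σ (knot p j) - p j * ε j)
    (fun j => ?_) fun k => ?_
  · rw [add_sub_cancel, lorenz_sub]
    exact Finset.sum_congr rfl fun i _ => mul_comm _ _
  · rw [Finset.sum_sub_distrib, sum_filter_le_eq_knot, sum_filter_le_eq_knot,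
      knot_sub_eq (fun l => lorenz q σ (knot p l)) k.2, knot_zero, lorenz_zero hq, sub_zero,
      ← lorenz_knot hp]
    exact sub_nonpos.2 (h _ k.2)

end Lorenz

theorem bscMix_isDegradation_bscMix_iff {m n : ℕ} {p : stdSimplex ℝ (Fin n)}
    {q : stdSimplex ℝ (Fin m)} {ε : Fin n → unitInterval} {σ : Fin m → unitInterval}
    (hε : Monotone ε) (hε_half : ∀ j, (ε j : ℝ) ≤ 1 / 2) (hσ : Monotone σ)
    (hσ_half : ∀ i, (σ i : ℝ) ≤ 1 / 2) :
    (bscMix p ε).IsDegradation (bscMix q σ) ↔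
      ∀ k ≤ n, lorenz q (fun i => σ i) (knot p k) ≤ lorenz p (fun j => ε j) (knot p k) := by
  refine ⟨fun h => ?_, fun h => ?_⟩
  · obtain ⟨t, ht⟩ := exists_isCoupling_of_isDegradation hσ_half h
    exact fun k _ => ht.lorenz_le (fun i l hil => hσ hil) k
  · obtain ⟨t, ht⟩ := exists_isCoupling_of_lorenz_le (stdSimplex.zero_le p) (stdSimplex.zero_le q)
      ((stdSimplex.sum_eq_one p).trans (stdSimplex.sum_eq_one q).symm) (fun i l hil => hε hil) h
    exact ht.isDegradation hε_half

section Snapping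

variable {α : Type*} [LinearOrder α] {N V B : Finset α} {a b : α}

/-- `a < b` are consecutive elements of the finite set `N` of knots. -/
structure IsPiece (N : Finset α) (a b : α) : Prop where
  left_mem : a ∈ N
  right_mem : b ∈ N
  lt : a < b
  le_or_le : ∀ z ∈ N, z ≤ a ∨ b ≤ z

/-- `B` arises from `V` by adding knots and by removing points of pieces with both end points
in `B`. -/
structure IsSnapping (N V B : Finset α) : Prop where
  subset : B ⊆ V ∪ N
  inter_subset : V ∩ N ⊆ B
  mem_or_mem_piece : ∀ v ∈ V, v ∈ B ∨ ∃ a b, IsPiece N a b ∧ a ∈ B ∧ b ∈ B ∧ v ∈ Set.Icc a b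

theorem IsSnapping.refl (N V : Finset α) : IsSnapping N V V :=
  ⟨Finset.subset_union_left, Finset.inter_subset_left, fun _ hv => Or.inl hv⟩

theorem IsSnapping.insert (h : IsSnapping N V B) {x : α} (hx : x ∈ N) :
    IsSnapping N V (insert x B) where
  subset := Finset.insert_subset (Finset.mem_union_right V hx) h.subset
  inter_subset := h.inter_subset.trans (Finset.subset_insert x B)
  mem_or_mem_piece v hv := (h.mem_or_mem_piece v hv).imp (Finset.mem_insert_of_mem ·)
    fun ⟨a, b, hab, ha, hb, hvab⟩ =>
      ⟨a, b, hab, Finset.mem_insert_of_mem ha, Finset.mem_insert_of_mem hb, hvab⟩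

/-- The set `B` with its points in `[a, b]` replaced by the two end points. -/
def snapTo (a b : α) (B : Finset α) : Finset α := insert a (insert b {z ∈ B | z ≤ a ∨ b ≤ z})

theorem IsPiece.inter_subset_snapTo (hab : IsPiece N a b) (B : Finset α) :
    B ∩ N ⊆ snapTo a b B := by
  intro z hz
  have hz' := Finset.mem_inter.1 hz
  simp [snapTo, hz'.1, hab.le_or_le z hz'.2]

theorem IsSnapping.snap (h : IsSnapping N V B) (hab : IsPiece N a b) :
    IsSnapping N V (snapTo a b B) where
  subset := Finset.insert_subset (Finset.mem_union_right V hab.left_mem) <|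
    Finset.insert_subset (Finset.mem_union_right V hab.right_mem) <|
      (Finset.filter_subset _ B).trans h.subset
  inter_subset := (Finset.subset_inter h.inter_subset Finset.inter_subset_right).trans
    (hab.inter_subset_snapTo B)
  mem_or_mem_piece v hv := by
    have ha : a ∈ snapTo a b B := by simp [snapTo]
    have hb : b ∈ snapTo a b B := by simp [snapTo]
    rcases h.mem_or_mem_piece v hv with hvB | ⟨c, d, hcd, hc, hd, hvcd⟩
    · by_cases hvab : v ≤ a ∨ b ≤ v
      · exact Or.inl (by simp [snapTo, hvB, hvab])
      · push Not at hvab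
        exact Or.inr ⟨a, b, hab, ha, hb, hvab.1.le, hvab.2.le⟩
    · exact Or.inr ⟨c, d, hcd, hab.inter_subset_snapTo B (Finset.mem_inter.2 ⟨hc, hcd.left_mem⟩),
        hab.inter_subset_snapTo B (Finset.mem_inter.2 ⟨hd, hcd.right_mem⟩), hvcd⟩

theorem card_snapTo_le {x y : α} (hx : x ∈ B) (hy : y ∈ B) (hax : a ≤ x) (hxy : x < y)
    (hyb : y ≤ b) : (snapTo a b B).card ≤ B.card := by
  have hsub : snapTo a b B ⊆ insert a (insert b ((B.erase x).erase y)) := by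
    intro z hz
    simp only [snapTo, Finset.mem_insert, Finset.mem_filter, Finset.mem_erase] at hz ⊢
    grind
  have hx' : x ∈ B.erase y := Finset.mem_erase.2 ⟨hxy.ne, hx⟩
  have hcard := Finset.card_erase_add_one hx'
  have hcard' := Finset.card_erase_add_one hy
  rw [Finset.erase_right_comm] at hcard
  exact (Finset.card_le_card hsub).trans <|
    (Finset.card_insert_le _ _).trans <| (Nat.succ_le_succ (Finset.card_insert_le _ _)).trans
      (by omega)

theorem card_snapTo_lt (ha : a ∈ B) (hb : b ∈ B) {x : α} (hx : x ∈ B) (hax : a < x) (hxb : x < b) :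
    (snapTo a b B).card < B.card := by
  refine Finset.card_lt_card (Finset.ssubset_iff_of_subset ?_ |>.2 ⟨x, hx, ?_⟩)
  · exact Finset.insert_subset ha (Finset.insert_subset hb (Finset.filter_subset _ B))
  · simp [snapTo, hax.ne', hxb.ne, hax, hxb]

theorem exists_isSnapping_forall_card_inter_le {k : ℕ} (N : Finset α) (hV : V.card ≤ k) :
    ∃ B, IsSnapping N V B ∧ B.card ≤ k ∧
      ∀ C, IsSnapping N V C → C.card ≤ k → (C ∩ N).card ≤ (B ∩ N).card := by
  classical
  obtain ⟨B, hB, hmax⟩ := Finset.exists_max_image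
    {B ∈ (V ∪ N).powerset | IsSnapping N V B ∧ B.card ≤ k} (fun B => (B ∩ N).card)
    ⟨V, Finset.mem_filter.2 ⟨Finset.mem_powerset.2 Finset.subset_union_left, .refl N V, hV⟩⟩
  obtain ⟨hsnap, hBk⟩ := (Finset.mem_filter.1 hB).2
  exact ⟨B, hsnap, hBk, fun C hC hCk =>
    hmax C (Finset.mem_filter.2 ⟨Finset.mem_powerset.2 hC.subset, hC, hCk⟩)⟩

-- The set `B` has the largest possible number of knots. It has exactly `k` elements since a knot
-- could be added otherwise, and snapping `B` to a piece neither gains a knot nor loses a point.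
theorem exists_isSnapping {k : ℕ} (hV : V.card ≤ k) (hN : k ≤ N.card) :
    ∃ B, IsSnapping N V B ∧ B.card = k ∧ ∀ a b, IsPiece N a b → ∀ x ∈ B, ∀ y ∈ B,
      a ≤ x → x < y → y ≤ b → x = a ∧ y = b := by
  obtain ⟨B, hB, hBk, hmax⟩ := exists_isSnapping_forall_card_inter_le N hV
  have hcard (C : Finset α) (hC : IsSnapping N V C) (hCk : C.card ≤ k) (hBC : B ∩ N ⊆ C) :
      C.card = k := by
    by_contra hne
    obtain ⟨x, hxN, hxC⟩ : ∃ x ∈ N, x ∉ C :=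
      Finset.exists_mem_notMem_of_card_lt_card ((lt_of_le_of_ne hCk hne).trans_le hN)
    have hins := hmax _ (hC.insert hxN) ((Finset.card_insert_le x C).trans (by omega))
    rw [Finset.insert_inter_of_mem hxN, Finset.card_insert_of_notMem (by simp [hxC])] at hins
    exact hins.not_gt (Nat.lt_succ_of_le (Finset.card_le_card
      (Finset.subset_inter hBC Finset.inter_subset_right)))
  refine ⟨B, hB, hcard B hB hBk Finset.inter_subset_left,
    fun a b hab x hx y hy hax hxy hyb => ?_⟩
  have hle := card_snapTo_le hx hy hax hxy hyb
  have hsnap := hB.snap hab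
  have hsub := hab.inter_subset_snapTo B
  have hknots : B ∩ N = snapTo a b B ∩ N := Finset.eq_of_subset_of_card_le
    (Finset.subset_inter hsub Finset.inter_subset_right) (hmax _ hsnap (hle.trans hBk))
  have hmem (z : α) (hz : z ∈ snapTo a b B ∩ N) : z ∈ B := Finset.inter_subset_left (hknots ▸ hz)
  have ha : a ∈ B := hmem a (by simp [snapTo, hab.left_mem])
  have hb : b ∈ B := hmem b (by simp [snapTo, hab.right_mem])
  have houter (z : α) (hz : z ∈ B) (haz : a < z) : b ≤ z := by
    by_contra! hzb
    have hlt := card_snapTo_lt ha hb hz haz hzb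
    exact (hlt.trans_le hBk).ne (hcard _ hsnap (hle.trans hBk) hsub)
  have hx_eq : x = a := hax.antisymm' (not_lt.1 fun h => (hxy.trans_le hyb).not_ge (houter x hx h))
  exact ⟨hx_eq, hyb.antisymm (houter y hy (hx_eq ▸ hxy))⟩

end Snapping

section Chords

variable {m n : ℕ} {q σ : Fin m → ℝ} {p w : Fin n → ℝ}

/-- The abscissas `knot q 0, …, knot q m` of the vertices of a Lorenz curve with weights `q`. -/
def knotSet (q : Fin m → ℝ) : Finset ℝ := (Finset.range (m + 1)).image (knot q)

theorem mem_knotSet {x : ℝ} : x ∈ knotSet q ↔ ∃ k ≤ m, knot q k = x := by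
  simp [knotSet]

theorem knot_mem_knotSet (q : Fin m → ℝ) {k : ℕ} (hk : k ≤ m) : knot q k ∈ knotSet q :=
  mem_knotSet.2 ⟨k, hk, rfl⟩

theorem card_knotSet_le (q : Fin m → ℝ) : (knotSet q).card ≤ m + 1 :=
  Finset.card_image_le.trans_eq (Finset.card_range _)

theorem card_knotSet (hq : ∀ i, 0 < q i) : (knotSet q).card = m + 1 := by
  rw [knotSet, Finset.card_image_of_injOn, Finset.card_range]
  exact (knot_strictMonoOn hq).injOn.mono fun k hk => Nat.lt_succ_iff.1 (Finset.mem_range.1 hk)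

theorem isPiece_knotSet_iff (hq : ∀ i, 0 < q i) {a b : ℝ} :
    IsPiece (knotSet q) a b ↔ ∃ i : Fin m, knot q i = a ∧ knot q (i + 1) = b := by
  have hmono := knot_mono fun i => (hq i).le
  constructor
  · rintro ⟨ha, hb, hlt, hle⟩
    obtain ⟨k, hk, rfl⟩ := mem_knotSet.1 ha
    obtain ⟨l, hl, rfl⟩ := mem_knotSet.1 hb
    have hkl : k < l := hmono.reflect_lt hlt
    refine ⟨⟨k, hkl.trans_le hl⟩, rfl, (hmono hkl).antisymm ?_⟩
    refine (hle _ (knot_mem_knotSet q (by omega : k + 1 ≤ m))).resolve_left (not_le.2 ?_)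
    exact knot_strictMonoOn hq hk (Set.mem_Iic.2 (by omega)) (Nat.lt_succ_self k)
  · rintro ⟨i, rfl, rfl⟩
    refine ⟨knot_mem_knotSet q i.2.le, knot_mem_knotSet q i.2, ?_, fun z hz => ?_⟩
    · exact knot_strictMonoOn hq i.2.le i.2 (Nat.lt_succ_self _)
    · obtain ⟨k, -, rfl⟩ := mem_knotSet.1 hz
      exact (le_or_gt k i).imp (fun h => hmono h) fun h => hmono h

theorem exists_knotSet_eq {B : Finset ℝ} (hB : B.card = n + 1) (h0 : 0 ∈ B)
    (hB_nonneg : ∀ x ∈ B, 0 ≤ x) : ∃ w : Fin n → ℝ, (∀ j, 0 < w j) ∧ knotSet w = B := by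
  let g := B.orderEmbOfFin hB
  let f : ℕ → ℝ := fun k => g (Fin.ofNat (n + 1) k)
  have hf_mem (k : ℕ) : f k ∈ B := B.orderEmbOfFin_mem hB _
  have hf : StrictMonoOn f (Set.Iic n) := fun k hk l hl hkl => g.strictMono <| by
    rw [Fin.lt_def, Fin.val_ofNat, Fin.val_ofNat, Nat.mod_eq_of_lt (Nat.lt_succ_of_le hk),
      Nat.mod_eq_of_lt (Nat.lt_succ_of_le hl)]
    exact hkl
  have hf0 : f 0 = 0 := by
    obtain ⟨i, hi⟩ : ∃ i, g i = 0 :=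
      (B.range_orderEmbOfFin hB).ge h0
    exact ((g.monotone (Fin.zero_le i)).trans_eq hi).antisymm (hB_nonneg _ (hf_mem 0))
  have hknot (k : ℕ) (hk : k ≤ n) : knot (fun j : Fin n => f (j + 1) - f j) k = f k := by
    rw [knot_sub_eq f hk, hf0, sub_zero]
  refine ⟨fun j => f (j + 1) - f j,
    fun j => sub_pos.2 (hf j.2.le j.2 (Nat.lt_succ_self _)), ?_⟩
  refine Finset.eq_of_subset_of_card_le (fun x hx => ?_) ?_
  · obtain ⟨k, hk, rfl⟩ := mem_knotSet.1 hx
    exact hknot k hk ▸ hf_mem k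
  · rw [hB, card_knotSet fun j => sub_pos.2 (hf j.2.le j.2 (Nat.lt_succ_self _))]

/-- The weights `w` cut the total mass of `q` into cells, and a cell or a union of adjacent cells
that lies in a piece of `q` is the whole piece. These are the weights of the compounds
`D_Q(i_2, …, i_n; s_2, …, s_n)` with the properties 1 and 2 of the theorem. -/
structure IsSnapped (q : Fin m → ℝ) (w : Fin n → ℝ) : Prop where
  pos : ∀ j, 0 < w j
  sum_eq : ∑ j, w j = ∑ i, q i
  eq_of_mem_piece : ∀ {i : Fin m} {c d : ℕ}, knot q i ≤ knot w c → knot w c < knot w d →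
    knot w d ≤ knot q (i + 1) → knot w c = knot q i ∧ knot w d = knot q (i + 1)

theorem exists_isSnapped (hnm : n ≤ m) (hp : ∀ j, 0 ≤ p j) (hq : ∀ i, 0 < q i)
    (hpq : ∑ j, p j = ∑ i, q i) :
    ∃ w : Fin n → ℝ, IsSnapped q w ∧ IsSnapping (knotSet q) (knotSet p) (knotSet w) := by
  obtain ⟨B, hB, hB_card, hB_piece⟩ := exists_isSnapping (card_knotSet_le p)
    ((Nat.succ_le_succ hnm).trans_eq (card_knotSet hq).symm)
  have hB_mem (x : ℝ) (hx : x ∈ B) : x ∈ Set.Icc 0 (∑ i, q i) := by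
    rcases Finset.mem_union.1 (hB.subset hx) with h | h
    · obtain ⟨k, -, rfl⟩ := mem_knotSet.1 h
      exact ⟨knot_nonneg hp k, hpq ▸ knot_le_sum hp k⟩
    · obtain ⟨k, -, rfl⟩ := mem_knotSet.1 h
      exact ⟨knot_nonneg (fun i => (hq i).le) k, knot_le_sum (fun i => (hq i).le) k⟩
  have h0 : 0 ∈ B := hB.inter_subset <| Finset.mem_inter.2
    ⟨mem_knotSet.2 ⟨0, Nat.zero_le _, knot_zero p⟩, mem_knotSet.2 ⟨0, Nat.zero_le _, knot_zero q⟩⟩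
  have hsum : ∑ i, q i ∈ B := hB.inter_subset <| Finset.mem_inter.2
    ⟨mem_knotSet.2 ⟨n, le_rfl, (knot_of_le p le_rfl).trans hpq⟩,
      mem_knotSet.2 ⟨m, le_rfl, knot_of_le q le_rfl⟩⟩
  obtain ⟨w, hw, rfl⟩ := exists_knotSet_eq hB_card h0 fun x hx => (hB_mem x hx).1
  have hw_sum : ∑ j, w j = ∑ i, q i := by
    obtain ⟨k, -, hk⟩ := mem_knotSet.1 hsum
    refine le_antisymm ?_ (hk ▸ knot_le_sum (fun j => (hw j).le) k)
    exact knot_of_le w le_rfl ▸ (hB_mem _ (knot_mem_knotSet w le_rfl)).2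
  have hknot_mem (c : ℕ) : knot w c ∈ knotSet w := by
    rcases le_total c n with hc | hc
    · exact knot_mem_knotSet w hc
    · rw [knot_of_le w hc, hw_sum]
      exact hsum
  exact ⟨w, ⟨hw, hw_sum, fun hc hcd hd => hB_piece _ _ ((isPiece_knotSet_iff hq).2 ⟨_, rfl, rfl⟩)
    _ (hknot_mem _) _ (hknot_mem _) hc hcd hd⟩, hB⟩

theorem weight_eq_of_knot_eq {i : Fin m} {j : Fin n} (h : knot w j = knot q i)
    (h' : knot w (j + 1) = knot q (i + 1)) : w j = q i := by
  rw [knot_succ, knot_succ, h] at h'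
  exact add_left_cancel h'

theorem weight_le_of_knot_le {i : Fin m} {j : Fin n} (h : knot w j ≤ knot q i)
    (h' : knot q (i + 1) ≤ knot w (j + 1)) : q i ≤ w j := by
  rw [knot_succ, knot_succ] at h'
  linarith

/-- The slope of the chord of the Lorenz curve of `q` and `σ` over the cell `j` of the weights `w`;
this is the crossover probability of the particle that is compounded from the cell. -/
def chordLevel (q σ : Fin m → ℝ) (w : Fin n → ℝ) (j : Fin n) : ℝ :=
  (lorenz q σ (knot w (j + 1)) - lorenz q σ (knot w j)) / w j

namespace IsSnapped

theorem knot_lt_knot_succ (hw : IsSnapped q w) (j : Fin n) : knot w j < knot w (j + 1) := by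
  rw [knot_succ]
  exact lt_add_of_pos_right _ (hw.pos j)

theorem knot_le_sum (hw : IsSnapped q w) (k : ℕ) : knot w k ≤ ∑ i, q i :=
  hw.sum_eq ▸ BIDMC.knot_le_sum (fun j => (hw.pos j).le) k

theorem knot_nonneg (hw : IsSnapped q w) (k : ℕ) : 0 ≤ knot w k :=
  BIDMC.knot_nonneg (fun j => (hw.pos j).le) k

theorem knot_eq_sum (hw : IsSnapped q w) : knot w n = ∑ i, q i :=
  (knot_of_le w le_rfl).trans hw.sum_eq

theorem lorenz_sub_eq_chordLevel_mul (hw : IsSnapped q w) (σ : Fin m → ℝ) (j : Fin n) :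
    lorenz q σ (knot w (j + 1)) - lorenz q σ (knot w j) =
      chordLevel q σ w j * (knot w (j + 1) - knot w j) := by
  rw [knot_succ, add_sub_cancel_left, chordLevel, ← knot_succ, div_mul_cancel₀ _ (hw.pos j).ne']

theorem chordLevel_mem_Icc (hw : IsSnapped q w) (hq : ∀ i, 0 ≤ q i) {a b : ℝ}
    (hσ : ∀ i, σ i ∈ Set.Icc a b) (j : Fin n) : chordLevel q σ w j ∈ Set.Icc a b := by
  have hlt := hw.knot_lt_knot_succ j
  have hmem := lorenz_sub_mem_Icc hq hσ (hw.knot_nonneg _) hlt.le (hw.knot_le_sum _)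
  rw [hw.lorenz_sub_eq_chordLevel_mul σ j] at hmem
  exact ⟨le_of_mul_le_mul_right hmem.1 (sub_pos.2 hlt),
    le_of_mul_le_mul_right hmem.2 (sub_pos.2 hlt)⟩

theorem chordLevel_le (hw : IsSnapped q w) (hq : ∀ i, 0 ≤ q i) (hσ : Monotone σ) {i : Fin m}
    {j : Fin n} (h : knot w (j + 1) ≤ knot q (i + 1)) : chordLevel q σ w j ≤ σ i := by
  have hlt := hw.knot_lt_knot_succ j
  refine le_of_mul_le_mul_right ?_ (sub_pos.2 hlt)
  exact hw.lorenz_sub_eq_chordLevel_mul σ j ▸ lorenz_sub_le hq hσ (hw.knot_nonneg _) hlt.le h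

theorem le_chordLevel (hw : IsSnapped q w) (hq : ∀ i, 0 ≤ q i) (hσ : Monotone σ) {i : Fin m}
    {j : Fin n} (h : knot q i ≤ knot w j) : σ i ≤ chordLevel q σ w j := by
  have hlt := hw.knot_lt_knot_succ j
  refine le_of_mul_le_mul_right ?_ (sub_pos.2 hlt)
  exact hw.lorenz_sub_eq_chordLevel_mul σ j ▸ le_lorenz_sub hq hσ h hlt.le (hw.knot_le_sum _)

theorem eq_of_le_chordLevel (hw : IsSnapped q w) (hq : ∀ i, 0 ≤ q i) (hσ : StrictMono σ) {i : Fin m}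
    {j : Fin n} (h : knot w (j + 1) ≤ knot q (i + 1)) (hj : σ i ≤ chordLevel q σ w j) :
    knot w j = knot q i ∧ knot w (j + 1) = knot q (i + 1) := by
  have hlt := hw.knot_lt_knot_succ j
  refine hw.eq_of_mem_piece (knot_le_of_le_lorenz_sub hq hσ (hw.knot_nonneg _) hlt h ?_) hlt h
  exact hw.lorenz_sub_eq_chordLevel_mul σ j ▸ mul_le_mul_of_nonneg_right hj (sub_pos.2 hlt).le

theorem eq_of_chordLevel_le (hw : IsSnapped q w) (hq : ∀ i, 0 ≤ q i) (hσ : StrictMono σ) {i : Fin m}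
    {j : Fin n} (h : knot q i ≤ knot w j) (hj : chordLevel q σ w j ≤ σ i) :
    knot w j = knot q i ∧ knot w (j + 1) = knot q (i + 1) := by
  have hlt := hw.knot_lt_knot_succ j
  refine hw.eq_of_mem_piece h hlt (le_knot_of_lorenz_sub_le hq hσ h hlt (hw.knot_le_sum _) ?_)
  exact hw.lorenz_sub_eq_chordLevel_mul σ j ▸ mul_le_mul_of_nonneg_right hj (sub_pos.2 hlt).le

theorem chordLevel_eq_of_knot_eq (hw : IsSnapped q w) (hq : ∀ i, 0 ≤ q i) (hσ : Monotone σ)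
    {i : Fin m} {j : Fin n} (h : knot w j = knot q i) (h' : knot w (j + 1) = knot q (i + 1)) :
    chordLevel q σ w j = σ i :=
  (hw.chordLevel_le hq hσ h'.le).antisymm (hw.le_chordLevel hq hσ h.ge)

theorem strictMono_chordLevel (hw : IsSnapped q w) (hq : ∀ i, 0 ≤ q i) (hσ : StrictMono σ) :
    StrictMono (chordLevel q σ w) := by
  have hadj (j l : Fin n) (hl : (l : ℕ) = j + 1) : chordLevel q σ w j < chordLevel q σ w l := by
    have hpos : 0 < knot w (j + 1) := (hw.knot_nonneg j).trans_lt (hw.knot_lt_knot_succ j)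
    obtain ⟨i, hi, hi'⟩ := exists_knot_lt_le hpos (hw.knot_le_sum _)
    have hle := hw.chordLevel_le hq hσ.monotone hi'
    have hge : σ i ≤ chordLevel q σ w l := hw.le_chordLevel hq hσ.monotone (hl ▸ hi.le)
    refine (hle.trans hge).lt_of_ne fun heq => hi.ne' ?_
    have := hw.eq_of_chordLevel_le hq hσ (hl ▸ hi.le : knot q i ≤ knot w l) (heq ▸ hle)
    exact hl ▸ this.1
  rcases n with _ | n
  · exact fun j => j.elim0
  · exact Fin.strictMono_iff_lt_succ.2 fun j => hadj _ _ rfl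

theorem lorenz_chordLevel_knot (hw : IsSnapped q w) (hq : ∀ i, 0 ≤ q i) (σ : Fin m → ℝ) {k : ℕ}
    (hk : k ≤ n) : lorenz w (chordLevel q σ w) (knot w k) = lorenz q σ (knot w k) := by
  have hterm (j : Fin n) : w j * chordLevel q σ w j =
      lorenz q σ (knot w (j + 1)) - lorenz q σ (knot w j) :=
    mul_div_cancel₀ _ (hw.pos j).ne'
  rw [lorenz_knot fun j => (hw.pos j).le]
  simp only [hterm]
  rw [knot_sub_eq (fun l => lorenz q σ (knot w l)) hk, knot_zero, lorenz_zero hq, sub_zero]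

theorem sum_mul_chordLevel (hw : IsSnapped q w) (hq : ∀ i, 0 ≤ q i) (σ : Fin m → ℝ) :
    ∑ j, w j * chordLevel q σ w j = ∑ i, q i * σ i := by
  rw [← knot_of_le _ le_rfl, ← lorenz_knot fun j => (hw.pos j).le,
    hw.lorenz_chordLevel_knot hq σ le_rfl, hw.knot_eq_sum, ← knot_of_le q le_rfl, lorenz_knot hq,
    knot_of_le _ le_rfl]

theorem lorenz_chordLevel_eq_of_isPiece (hw : IsSnapped q w) (hq : ∀ i, 0 < q i)
    (hσ : StrictMono σ) {a b x : ℝ} (hab : IsPiece (knotSet q) a b) (ha : a ∈ knotSet w)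
    (hb : b ∈ knotSet w) (hx : x ∈ Set.Icc a b) :
    lorenz w (chordLevel q σ w) x = lorenz q σ x := by
  have hq' := fun i => (hq i).le
  have hw' := fun j => (hw.pos j).le
  obtain ⟨c, -, rfl⟩ := mem_knotSet.1 ha
  obtain ⟨d, hd, rfl⟩ := mem_knotSet.1 hb
  obtain ⟨i, hi, hi'⟩ := (isPiece_knotSet_iff hq).1 hab
  have hcd : c < d := (knot_mono hw').reflect_lt hab.lt
  let j : Fin n := ⟨c, hcd.trans_le hd⟩
  have hj : knot w (j + 1) = knot q (i + 1) :=
    (hw.eq_of_mem_piece hi.le (hw.knot_lt_knot_succ j) (hi' ▸ knot_mono hw' hcd)).2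
  have hx' : x ≤ knot q (i + 1) := hx.2.trans_eq hi'.symm
  have hlevel : chordLevel q σ w j = σ i := hw.chordLevel_eq_of_knot_eq hq' hσ.monotone hi.symm hj
  have hstart : lorenz w (chordLevel q σ w) (knot w c) = lorenz q σ (knot w c) :=
    hw.lorenz_chordLevel_knot hq' σ j.2.le
  have hchord := lorenz_sub_eq hw' (hw.strictMono_chordLevel hq' hσ).monotone (i := j) le_rfl
    hx.1 (hx'.trans_eq hj.symm)
  have hcurve := lorenz_sub_eq hq' hσ.monotone hi.le hx.1 hx'
  rw [hlevel] at hchord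
  linarith

theorem lorenz_chordLevel_eq_of_isSnapping (hw : IsSnapped q w) (hq : ∀ i, 0 < q i)
    (hσ : StrictMono σ) {V : Finset ℝ} (hV : IsSnapping (knotSet q) V (knotSet w)) {x : ℝ}
    (hx : x ∈ V) : lorenz w (chordLevel q σ w) x = lorenz q σ x := by
  rcases hV.mem_or_mem_piece x hx with hxw | ⟨a, b, hab, ha, hb, hxab⟩
  · obtain ⟨k, hk, rfl⟩ := mem_knotSet.1 hxw
    exact hw.lorenz_chordLevel_knot (fun i => (hq i).le) σ hk
  · exact hw.lorenz_chordLevel_eq_of_isPiece hq hσ hab ha hb hxab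

theorem weight_le_of_chordLevel_eq (hw : IsSnapped q w) (hq : ∀ i, 0 ≤ q i) (hσ : StrictMono σ)
    {i : Fin m} {j : Fin n} (h : chordLevel q σ w j = σ i) : q i ≤ w j := by
  rcases le_total (knot q i) (knot w j) with hi | hi
  · obtain ⟨h1, h2⟩ := hw.eq_of_chordLevel_le hq hσ hi h.le
    exact (weight_eq_of_knot_eq h1 h2).ge
  rcases le_total (knot w (j + 1)) (knot q (i + 1)) with hi' | hi'
  · obtain ⟨h1, h2⟩ := hw.eq_of_le_chordLevel hq hσ hi' h.ge
    exact (weight_eq_of_knot_eq h1 h2).ge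
  · exact weight_le_of_knot_le hi hi'

theorem weight_first_le (hw : IsSnapped q w) {i : Fin m} {j : Fin n} (hi : (i : ℕ) = 0)
    (hj : (j : ℕ) = 0) : q i ≤ w j := by
  have h : knot w j = knot q i := by rw [hi, hj, knot_zero, knot_zero]
  rcases le_total (knot w (j + 1)) (knot q (i + 1)) with h' | h'
  · exact (weight_eq_of_knot_eq h (hw.eq_of_mem_piece h.ge (hw.knot_lt_knot_succ j) h').2).ge
  · exact weight_le_of_knot_le h.le h'

theorem weight_last_le (hw : IsSnapped q w) {i : Fin m} {j : Fin n} (hi : (i : ℕ) + 1 = m)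
    (hj : (j : ℕ) + 1 = n) : q i ≤ w j := by
  have h' : knot w (j + 1) = knot q (i + 1) := by
    rw [hi, hj, hw.knot_eq_sum, knot_of_le q le_rfl]
  rcases le_total (knot q i) (knot w j) with h | h
  · exact (weight_eq_of_knot_eq (hw.eq_of_mem_piece h (hw.knot_lt_knot_succ j) h'.le).1 h').ge
  · exact weight_le_of_knot_le h h'.ge

end IsSnapped

end Chords

section Patterns

variable {m n : ℕ} {q σ : Fin m → ℝ} {w : Fin n → ℝ}

theorem labelled_succ (f : Fin m → ℝ) (i : Fin m) : labelled f (i + 1) = f i := by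
  simp [labelled]

theorem labelled_of_lt (f : Fin m → ℝ) {l : ℕ} (hl : m < l) : labelled f l = 0 :=
  dif_neg fun h => hl.not_ge h.2

theorem labelled_mul (f g : Fin m → ℝ) (l : ℕ) :
    labelled (fun i => f i * g i) l = labelled f l * labelled g l := by
  simp only [labelled]
  split_ifs <;> simp

theorem labelled_mem_Icc {a b : ℝ} (h0 : 0 ∈ Set.Icc a b) (hσ : ∀ i, σ i ∈ Set.Icc a b) (l : ℕ) :
    labelled σ l ∈ Set.Icc a b := by
  unfold labelled
  split_ifs
  · exact hσ _
  · exact h0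

-- For `l = 0` both sides vanish because the subtraction `l - 1` is truncated.
theorem labelled_eq_knot_sub (q : Fin m → ℝ) (l : ℕ) :
    labelled q l = knot q l - knot q (l - 1) := by
  rcases l with _ | l
  · simp [labelled]
  rcases lt_or_ge l m with hl | hl
  · rw [labelled_succ q ⟨l, hl⟩, Nat.add_sub_cancel, knot_succ q ⟨l, hl⟩, add_sub_cancel_left]
  · rw [labelled_of_lt q (by omega), Nat.add_sub_cancel, knot_of_le q hl,
      knot_of_le q (hl.trans (Nat.le_succ l)), sub_self]

theorem sum_labelled (f : Fin m → ℝ) {S : Finset ℕ} (hS : ∀ l ∉ S, labelled f l = 0) :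
    ∑ l ∈ S, labelled f l = ∑ i, f i := by
  classical
  let T := Finset.univ.map (Fin.valEmbedding.trans (addRightEmbedding 1) : Fin m ↪ ℕ)
  have hT : ∀ l ∉ T, labelled f l = 0 := fun l hl => dif_neg fun h => hl <|
    Finset.mem_map.2 ⟨⟨l - 1, by omega⟩, Finset.mem_univ _, Nat.sub_add_cancel h.1⟩
  calc ∑ l ∈ S, labelled f l = ∑ l ∈ S ∪ T, labelled f l :=
        Finset.sum_subset Finset.subset_union_left fun l _ => hS l
    _ = ∑ l ∈ T, labelled f l :=
        (Finset.sum_subset Finset.subset_union_right fun l _ => hT l).symm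
    _ = ∑ i, f i :=
        (Finset.sum_map _ _ _).trans (Finset.sum_congr rfl fun i _ => labelled_succ f i)

theorem segment_of_notMem {a b l : ℕ} (hab : a ≤ b) (hl : l ∉ Finset.Icc a b) (t t' : ℝ) :
    segment q a b t t' l = 0 := by
  rw [Finset.mem_Icc] at hl
  rw [segment, if_neg (by omega), if_neg (by omega), if_neg (by omega)]

theorem segment_succ (hq : ∀ i, 0 ≤ q i) {a b : ℕ} (hab : a < b) {x y : ℝ}
    (hx : x ∈ Set.Icc (knot q (a - 1)) (knot q a)) (hy : y ∈ Set.Icc (knot q (b - 1)) (knot q b))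
    (i : Fin m) : segment q a b (knot q a - x) (knot q b - y) (i + 1) =
      overlap (knot q) y i - overlap (knot q) x i := by
  have hmono := knot_mono hq
  rcases lt_trichotomy a (i + 1) with ha | rfl | ha
  · rw [overlap_of_le hmono (hx.2.trans (hmono (Nat.lt_succ_iff.1 ha))), sub_zero]
    rcases lt_trichotomy b (i + 1) with hb | rfl | hb
    · rw [overlap_of_le hmono (hy.2.trans (hmono (Nat.lt_succ_iff.1 hb)))]
      exact segment_of_notMem hab.le (fun h => hb.not_ge (Finset.mem_Icc.1 h).2) _ _
    · rw [Nat.add_sub_cancel] at hy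
      rw [overlap_of_mem hy.1 hy.2, segment, if_neg ha.ne', if_pos rfl, labelled_succ, knot_succ]
      ring
    · rw [overlap_of_ge hmono ((hmono (Nat.le_sub_one_of_lt hb)).trans hy.1), segment,
        if_neg ha.ne', if_neg hb.ne, if_pos ⟨ha, hb⟩, labelled_succ, knot_succ,
        add_sub_cancel_left]
  · rw [Nat.add_sub_cancel] at hx
    rw [overlap_of_mem hx.1 hx.2,
      overlap_of_ge hmono ((hmono (Nat.le_sub_one_of_lt hab)).trans hy.1), segment, if_pos rfl]
    ring
  · rw [overlap_of_ge hmono ((hmono (Nat.le_sub_one_of_lt ha)).trans hx.1),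
      overlap_of_ge hmono ((hmono (Nat.le_sub_one_of_lt (ha.trans hab))).trans hy.1), sub_self]
    exact segment_of_notMem hab.le (fun h => ha.not_ge (Finset.mem_Icc.1 h).1) _ _

theorem segment_eq_labelled (hq : ∀ i, 0 ≤ q i) {a b : ℕ} (hab : a < b) {x y : ℝ}
    (hx : x ∈ Set.Icc (knot q (a - 1)) (knot q a)) (hy : y ∈ Set.Icc (knot q (b - 1)) (knot q b)) :
    segment q a b (knot q a - x) (knot q b - y) =
      labelled fun i : Fin m => overlap (knot q) y i - overlap (knot q) x i := by
  funext l
  by_cases hl : 1 ≤ l ∧ l ≤ m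
  · obtain ⟨i, rfl⟩ : ∃ i : Fin m, l = i + 1 := ⟨⟨l - 1, by omega⟩, by dsimp only; omega⟩
    rw [labelled_succ, segment_succ hq hab hx hy]
  have hzero (f : Fin m → ℝ) : labelled f l = 0 := dif_neg hl
  have hflat : knot q l - knot q (l - 1) = 0 := labelled_eq_knot_sub q l ▸ hzero q
  rw [hzero, segment]
  split_ifs with hla hlb hlab
  · subst hla
    linarith [hx.1, hx.2]
  · subst hlb
    linarith [hy.1, hy.2, hzero q]
  · exact hzero q
  · rfl

theorem isCompounded_segment (hq : ∀ i, 0 ≤ q i) (hσ : ∀ i, σ i ∈ Set.Icc (0 : ℝ) (1 / 2))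
    {a b : ℕ} (hab : a < b) {x y ε : ℝ} (hx : x ∈ Set.Icc (knot q (a - 1)) (knot q a))
    (hy : y ∈ Set.Icc (knot q (b - 1)) (knot q b))
    (hε : lorenz q σ y - lorenz q σ x = ε * (y - x)) :
    IsCompounded (y - x) ε (Finset.Icc a b) (segment q a b (knot q a - x) (knot q b - y))
      (labelled σ) := by
  have hmem {z : ℝ} {c : ℕ} (hz : z ∈ Set.Icc (knot q (c - 1)) (knot q c)) :
      z ∈ Set.Icc 0 (∑ i, q i) :=
    ⟨(knot_nonneg hq _).trans hz.1, hz.2.trans (knot_le_sum hq _)⟩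
  have hzero (l : ℕ) (hl : l ∉ Finset.Icc a b) :
      labelled (fun i : Fin m => overlap (knot q) y i - overlap (knot q) x i) l = 0 := by
    rw [← segment_eq_labelled hq hab hx hy, segment_of_notMem hab.le hl]
  rw [segment_eq_labelled hq hab hx hy]
  refine ⟨?_, fun l _ => labelled_mem_Icc (by norm_num) hσ l, ?_⟩
  · rw [sum_labelled _ hzero, Finset.sum_sub_distrib, sum_overlap_knot (hmem hx),
      sum_overlap_knot (hmem hy)]
  · simp only [← labelled_mul]
    rw [sum_labelled _ fun l hl => by rw [labelled_mul, hzero l hl, zero_mul], mul_comm, ← hε,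
      lorenz_sub]
    exact Finset.sum_congr rfl fun i _ => mul_comm _ _

/-- The splitting patterns `T` cut the pieces of the weights `q` at the knots of the weights `w`:
the knot `j` lies in the piece with label `T.pos j`, and `T.split j` is the part of the piece above
the knot. -/
def IsCutAt (T : SplittingPatterns q n) (w : Fin n → ℝ) : Prop :=
  ∀ j : Fin (n + 1), T.split j = knot q (T.pos j) - knot w j

namespace IsCutAt

variable {T : SplittingPatterns q n}

theorem knot_mem (hT : IsCutAt T w) (j : Fin (n + 1)) :
    knot w j ∈ Set.Icc (knot q (T.pos j - 1)) (knot q (T.pos j)) := by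
  have hmem := T.split_mem j
  rw [hT j, labelled_eq_knot_sub] at hmem
  exact ⟨by linarith [hmem.2], by linarith [hmem.1]⟩

theorem isCompounded (hT : IsCutAt T w) (hw : IsSnapped q w) (hq : ∀ i, 0 ≤ q i)
    (hσ : ∀ i, σ i ∈ Set.Icc (0 : ℝ) (1 / 2)) (j : Fin n) :
    IsCompounded (w j) (chordLevel q σ w j) (Finset.Icc (T.pos j.castSucc) (T.pos j.succ))
      (segment q (T.pos j.castSucc) (T.pos j.succ) (T.split j.castSucc) (T.split j.succ))
      (labelled σ) := by
  have hwj : w j = knot w (j + 1) - knot w j := by rw [knot_succ, add_sub_cancel_left]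
  rw [hT, hT, hwj]
  exact isCompounded_segment hq hσ (T.pos_strictMono j.castSucc_lt_succ) (hT.knot_mem _)
    (hT.knot_mem _) (hw.lorenz_sub_eq_chordLevel_mul σ j)

theorem eq_labelled_of_split_eq_zero (hT : IsCutAt T w) (hw : IsSnapped q w) (hq : ∀ i, 0 ≤ q i)
    (hσ : Monotone σ) {j : Fin n} (hj : T.pos j.succ = T.pos j.castSucc + 1)
    (h : T.split j.castSucc = 0) :
    T.split j.succ = 0 ∧ w j = labelled q (T.pos j.succ) ∧
      chordLevel q σ w j = labelled σ (T.pos j.succ) := by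
  have hlt := hw.knot_lt_knot_succ j
  have hleft : knot w j = knot q (T.pos j.castSucc) := (sub_eq_zero.1 (hT _ ▸ h)).symm
  have hpos : T.pos j.castSucc < m := by
    by_contra! hm
    exact (hw.knot_le_sum _).not_gt (hleft.trans (knot_of_le q hm) ▸ hlt)
  obtain ⟨i, hi⟩ : ∃ i : Fin m, (i : ℕ) = T.pos j.castSucc := ⟨⟨_, hpos⟩, rfl⟩
  rw [← hi] at hleft hj
  have hright : knot w (j + 1) = knot q (i + 1) :=
    (hw.eq_of_mem_piece hleft.ge hlt (hj ▸ (hT.knot_mem j.succ).2)).2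
  rw [hT, hj, labelled_succ, labelled_succ]
  exact ⟨sub_eq_zero.2 hright.symm, weight_eq_of_knot_eq hleft hright,
    hw.chordLevel_eq_of_knot_eq hq hσ hleft hright⟩

theorem eq_labelled_of_split_eq_labelled (hT : IsCutAt T w) (hw : IsSnapped q w)
    (hq : ∀ i, 0 ≤ q i) (hσ : Monotone σ) {j : Fin n} (hj : T.pos j.succ = T.pos j.castSucc + 1)
    (h : T.split j.succ = labelled q (T.pos j.succ)) :
    T.split j.castSucc = labelled q (T.pos j.castSucc) ∧ w j = labelled q (T.pos j.castSucc) ∧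
      chordLevel q σ w j = labelled σ (T.pos j.castSucc) := by
  have hlt := hw.knot_lt_knot_succ j
  have hright : knot w (j + 1) = knot q (T.pos j.castSucc) := by
    rw [hT, labelled_eq_knot_sub, hj, Nat.add_sub_cancel] at h
    exact sub_right_injective h
  obtain ⟨k, hk⟩ : ∃ k, T.pos j.castSucc = k + 1 := Nat.exists_eq_succ_of_ne_zero fun h0 => by
    rw [h0, knot_zero] at hright
    exact (hw.knot_nonneg _).not_gt (hright ▸ hlt)
  have hkm : k < m := by
    have := T.pos_last ▸ T.pos_strictMono.monotone (Fin.le_last j.succ)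
    omega
  obtain ⟨i, rfl⟩ : ∃ i : Fin m, (i : ℕ) = k := ⟨⟨_, hkm⟩, rfl⟩
  rw [hk] at hright
  have hle : knot q i ≤ knot w j := by simpa [hk] using (hT.knot_mem j.castSucc).1
  have hleft : knot w j = knot q i := (hw.eq_of_mem_piece hle hlt hright.le).1
  have hwj := weight_eq_of_knot_eq hleft hright
  rw [hT, hk, labelled_succ, labelled_succ]
  refine ⟨?_, hwj, hw.chordLevel_eq_of_knot_eq hq hσ hleft hright⟩
  rw [knot_succ, Fin.val_castSucc, hleft, add_sub_cancel_left]

end IsCutAt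

theorem exists_label (hq : 0 < ∑ i, q i) {x : ℝ} (hx : x ∈ Set.Icc 0 (∑ i, q i)) :
    ∃ l, x ∈ Set.Icc (knot q (l - 1)) (knot q l) ∧ (x = 0 → l = 0) ∧ (x = ∑ i, q i → l = m + 1) ∧
      (x ≠ 0 → x ≠ ∑ i, q i → ∃ i : Fin m, l = i + 1 ∧ knot q i < x) := by
  rcases eq_or_ne x 0 with rfl | h0
  · exact ⟨0, by simp [knot_zero], fun _ => rfl, fun h => absurd h hq.ne, fun h => absurd rfl h⟩
  rcases eq_or_ne x (∑ i, q i) with rfl | hsum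
  · refine ⟨m + 1, ?_, fun h => absurd h h0, fun _ => rfl, fun _ h => absurd rfl h⟩
    rw [Nat.add_sub_cancel, knot_of_le q le_rfl, knot_of_le q (Nat.le_succ m), Set.Icc_self]
    exact rfl
  obtain ⟨i, hi, hi'⟩ := exists_knot_lt_le (hx.1.lt_of_ne h0.symm) hx.2
  exact ⟨i + 1, ⟨hi.le, hi'⟩, fun h => absurd h h0, fun h => absurd h hsum,
    fun _ _ => ⟨i, rfl, hi⟩⟩

theorem IsSnapped.exists_isCutAt (hw : IsSnapped q w) (hq : ∀ i, 0 ≤ q i) (hn : 0 < n) :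
    ∃ T : SplittingPatterns q n, IsCutAt T w := by
  have hsum : 0 < ∑ i, q i :=
    ((hw.knot_nonneg 0).trans_lt (hw.knot_lt_knot_succ ⟨0, hn⟩)).trans_le (hw.knot_le_sum _)
  choose pos hmem hpos_zero hpos_last hpos using fun j : Fin (n + 1) =>
    exists_label hsum ⟨hw.knot_nonneg j, hw.knot_le_sum j⟩
  have hpos0 : pos 0 = 0 := hpos_zero 0 (knot_zero w)
  have hposn : pos (Fin.last n) = m + 1 := hpos_last _ hw.knot_eq_sum
  have hmono : StrictMono pos := by
    refine Fin.strictMono_iff_lt_succ.2 fun j => ?_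
    by_contra! hle
    have hlt := hw.knot_lt_knot_succ j
    have hright : knot w (j + 1) ≤ knot q (pos j.castSucc) :=
      (hmem j.succ).2.trans (knot_mono hq hle)
    have hne : knot w j ≠ 0 := fun h0 => by
      rw [hpos_zero _ h0, knot_zero] at hright
      exact (hright.trans_eq h0.symm).not_gt hlt
    obtain ⟨i, hi, hleft⟩ := hpos j.castSucc hne (hlt.trans_le (hw.knot_le_sum _)).ne
    exact hleft.ne' (hw.eq_of_mem_piece hleft.le hlt (hi ▸ hright)).1
  exact ⟨⟨pos, fun j => knot q (pos j) - knot w j, hpos0, hposn, hmono,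
    by simp [hpos0, knot_zero],
    by simp [hposn, knot_of_le q (Nat.le_succ m), hw.knot_eq_sum],
    fun j => ⟨sub_nonneg.2 (hmem j).2,
      labelled_eq_knot_sub q (pos j) ▸ sub_le_sub_left (hmem j).1 _⟩⟩, fun _ => rfl⟩

end Patterns

theorem isPDegradation_of_errorProb_eq {m n : ℕ} {W Q : BIDMC} (hQ : Q ∈ SymSet m)
    (hW : W ∈ SymSet n) (hWQ : W.IsDegradation Q) (h : W.errorProb = Q.errorProb) :
    IsPDegradation m n W Q := by
  refine ⟨hQ, hW, hWQ, ⟨W, ⟨hW, hWQ⟩, rfl⟩, ?_⟩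
  rintro _ ⟨W', ⟨-, hW'⟩, rfl⟩
  exact h.trans_le hW'.errorProb_le

theorem IsPDegradation.errorProb_eq {m n : ℕ} {W D Q : BIDMC} (h : IsPDegradation m n W Q)
    (hD : D ∈ SymSet n) (hDQ : D.IsDegradation Q) (hDe : D.errorProb = Q.errorProb) :
    W.errorProb = Q.errorProb :=
  le_antisymm (hDe ▸ h.2.2.2.2 ⟨D, ⟨hD, hDQ⟩, rfl⟩) h.2.2.1.errorProb_le

section Compounds

variable {m n : ℕ} {q : stdSimplex ℝ (Fin m)} {σ : Fin m → unitInterval}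
  {p r : stdSimplex ℝ (Fin n)} {ε η : Fin n → unitInterval}

/-- The channel `∑ j, p j • B(ε j)` is compounded from the channel `∑ i, q i • B(σ i)` along snapped
cells, so that its Lorenz curve is inscribed in the Lorenz curve of `∑ i, q i • B(σ i)`. -/
structure IsChordCompound (q : stdSimplex ℝ (Fin m)) (σ : Fin m → unitInterval)
    (p : stdSimplex ℝ (Fin n)) (ε : Fin n → unitInterval) : Prop where
  isSnapped : IsSnapped q p
  level_eq : ∀ j, (ε j : ℝ) = chordLevel q (fun i => σ i) p j

theorem exists_isChordCompound (hnm : n ≤ m) (r : stdSimplex ℝ (Fin n)) (hq : ∀ i, 0 < q i)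
    (σ : Fin m → unitInterval) :
    ∃ (p : stdSimplex ℝ (Fin n)) (ε : Fin n → unitInterval), IsChordCompound q σ p ε ∧
      IsSnapping (knotSet q) (knotSet r) (knotSet p) := by
  obtain ⟨w, hw, hsnap⟩ := exists_isSnapped hnm (stdSimplex.zero_le r) hq
    ((stdSimplex.sum_eq_one r).trans (stdSimplex.sum_eq_one q).symm)
  refine ⟨⟨w, fun j => (hw.pos j).le, hw.sum_eq.trans (stdSimplex.sum_eq_one q)⟩,
    fun j => ⟨chordLevel q (fun i => σ i) w j, ?_⟩, ⟨hw, fun _ => rfl⟩, hsnap⟩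
  exact hw.chordLevel_mem_Icc (stdSimplex.zero_le q) (fun i => (σ i).2) j

namespace IsChordCompound

theorem strictMono (h : IsChordCompound q σ p ε) (hσ : StrictMono σ) : StrictMono ε :=
  fun j l hjl => by
    have hlt := h.isSnapped.strictMono_chordLevel (stdSimplex.zero_le q) (fun _ _ hi => hσ hi) hjl
    rwa [← h.level_eq, ← h.level_eq] at hlt

theorem level_le_half (h : IsChordCompound q σ p ε) (hσ : ∀ i, (σ i : ℝ) ≤ 1 / 2) (j : Fin n) :
    (ε j : ℝ) ≤ 1 / 2 :=
  h.level_eq j ▸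
    (h.isSnapped.chordLevel_mem_Icc (stdSimplex.zero_le q) (fun i => ⟨(σ i).2.1, hσ i⟩) j).2

theorem isDegradation (h : IsChordCompound q σ p ε) (hσ : StrictMono σ)
    (hσ_half : ∀ i, (σ i : ℝ) ≤ 1 / 2) : (bscMix p ε).IsDegradation (bscMix q σ) := by
  rw [bscMix_isDegradation_bscMix_iff (h.strictMono hσ).monotone (h.level_le_half hσ_half)
    hσ.monotone hσ_half]
  intro k hk
  simp only [h.level_eq]
  exact (h.isSnapped.lorenz_chordLevel_knot (stdSimplex.zero_le q) _ hk).ge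

theorem isDegradation_of_isSnapping (h : IsChordCompound q σ p ε) (hq : ∀ i, 0 < q i)
    (hσ : StrictMono σ) (hσ_half : ∀ i, (σ i : ℝ) ≤ 1 / 2) (hη : Monotone η)
    (hη_half : ∀ j, (η j : ℝ) ≤ 1 / 2) (hr : IsSnapping (knotSet q) (knotSet r) (knotSet p))
    (hrq : (bscMix r η).IsDegradation (bscMix q σ)) :
    (bscMix r η).IsDegradation (bscMix p ε) := by
  rw [bscMix_isDegradation_bscMix_iff hη hη_half hσ.monotone hσ_half] at hrq
  rw [bscMix_isDegradation_bscMix_iff hη hη_half (h.strictMono hσ).monotone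
    (h.level_le_half hσ_half)]
  intro k hk
  simp only [h.level_eq]
  rw [h.isSnapped.lorenz_chordLevel_eq_of_isSnapping hq (fun _ _ hi => hσ hi) hr
    (knot_mem_knotSet r hk)]
  exact hrq k hk

theorem errorProb_eq (h : IsChordCompound q σ p ε) (hσ : ∀ i, (σ i : ℝ) ≤ 1 / 2) :
    (bscMix p ε).errorProb = (bscMix q σ).errorProb := by
  rw [bscMix_errorProb p (h.level_le_half hσ), bscMix_errorProb q hσ]
  simp only [h.level_eq]
  rw [h.isSnapped.sum_mul_chordLevel (stdSimplex.zero_le q)]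

theorem isSegmentCompound (h : IsChordCompound q σ p ε) (hn : 0 < n) (hσ : StrictMono σ)
    (hσ_half : ∀ i, (σ i : ℝ) ≤ 1 / 2) {T : SplittingPatterns q n} (hT : IsCutAt T p) :
    IsSegmentCompound q σ T p ε where
  mem_star := bscMix_mem_symSetStar hn h.isSnapped.pos (h.strictMono hσ) (h.level_le_half hσ_half)
  compounded j := h.level_eq j ▸
    hT.isCompounded h.isSnapped (stdSimplex.zero_le q) (fun i => ⟨(σ i).2.1, hσ_half i⟩) j

end IsChordCompound

end Compounds

end BIDMC

end

theorem theorem3 (m n : ℕ) (hn : 2 ≤ n) (hmn : n < m)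
    (q : stdSimplex ℝ (Fin m)) (σ : Fin m → unitInterval)
    (hσ : StrictMono σ) (hσ_half : ∀ i, (σ i : ℝ) ≤ 1 / 2)
    (Q : BIDMC) (hQ : Q.Equivalent (BIDMC.bscMix q σ)) (hQ_star : Q ∈ BIDMC.SymSetStar m)
    (W : BIDMC) (hW : W ∈ BIDMC.SymSet n) (hWQ : W.IsDegradation Q) :
    ∃ (T : BIDMC.SplittingPatterns q n) (p : stdSimplex ℝ (Fin n)) (ε : Fin n → unitInterval),
      BIDMC.IsSegmentCompound q σ T p ε ∧
      W.IsDegradation (BIDMC.bscMix p ε) ∧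
      (BIDMC.IsPDegradation m n W Q → BIDMC.IsPDegradation n n W (BIDMC.bscMix p ε)) ∧
      BIDMC.IsPDegradation m n (BIDMC.bscMix p ε) Q ∧
      StrictMono ε ∧ (∀ j, (ε j : ℝ) ≤ 1 / 2) ∧
      (∀ j : Fin n, T.pos j.succ = T.pos j.castSucc + 1 →
        (T.split j.castSucc = 0 →
          T.split j.succ = 0 ∧
          p j = BIDMC.labelled q (T.pos j.succ) ∧
          (ε j : ℝ) = BIDMC.labelled (fun i => (σ i : ℝ)) (T.pos j.succ)) ∧
        (T.split j.succ = BIDMC.labelled q (T.pos j.succ) →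
          T.split j.castSucc = BIDMC.labelled q (T.pos j.castSucc) ∧
          p j = BIDMC.labelled q (T.pos j.castSucc) ∧
          (ε j : ℝ) = BIDMC.labelled (fun i => (σ i : ℝ)) (T.pos j.castSucc))) ∧
      (∀ (j : Fin n) (i : Fin m), ε j = σ i → q i ≤ p j) ∧
      q ⟨0, by omega⟩ ≤ p ⟨0, by omega⟩ ∧
      q ⟨m - 1, by omega⟩ ≤ p ⟨n - 1, by omega⟩ := by
  obtain ⟨r, η, hWr, hη, hη_half⟩ := BIDMC.exists_monotone_bscMix hW
  have hq := BIDMC.pos_of_mem_symSetStar hQ hQ_star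
  have hq' := stdSimplex.zero_le q
  have hσ' : StrictMono fun i => (σ i : ℝ) := fun _ _ h => hσ h
  obtain ⟨p, ε, hpε, hr⟩ := BIDMC.exists_isChordCompound hmn.le r hq σ
  have hp := hpε.isSnapped
  obtain ⟨T, hT⟩ := hp.exists_isCutAt hq' (by omega)
  have hD := hpε.isSegmentCompound (by omega) hσ hσ_half hT
  have hDn := hD.mem_star.1
  have hDQ := (hpε.isDegradation hσ hσ_half).trans hQ.symm.isDegradation
  have hWD := hWr.isDegradation.trans (hpε.isDegradation_of_isSnapping hq hσ hσ_half hη hη_half hr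
    ((hWr.symm.isDegradation.trans hWQ).trans hQ.isDegradation))
  have herr := (hpε.errorProb_eq hσ_half).trans hQ.errorProb_eq.symm
  refine ⟨T, p, ε, hD, hWD, fun hP => ?_, ?_, hpε.strictMono hσ, hpε.level_le_half hσ_half,
    fun j hj => ?_, fun j i h => ?_, hp.weight_first_le rfl rfl,
    hp.weight_last_le (Nat.sub_add_cancel (by omega)) (Nat.sub_add_cancel (by omega))⟩
  · exact BIDMC.isPDegradation_of_errorProb_eq hDn hW hWD
      ((hP.errorProb_eq hDn hDQ herr).trans herr.symm)
  · exact BIDMC.isPDegradation_of_errorProb_eq hQ_star.1 hDn hDQ herr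
  · exact hpε.level_eq j ▸ ⟨hT.eq_labelled_of_split_eq_zero hp hq' hσ'.monotone hj,
      hT.eq_labelled_of_split_eq_labelled hp hq' hσ'.monotone hj⟩
  · exact hp.weight_le_of_chordLevel_eq hq' hσ' ((hpε.level_eq j).symm.trans (congrArg _ h))
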